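/- Let $\lambda\ge 0$, $\sigma_1>0$, $\sigma_2\ge 0$, $\kappa,\rho,\delta>0$, and let $c:[0,\infty)\to[0,\infty)$ be strictly convex, strictly increasing and twice continuously differentiable. Set \[ f(\gamma,h):=-\bigl(\sigma_1^{-2}+h\bigr)\gamma^2-2\lambda\gamma+\sigma_2^2,\qquad \gamma^0_\infty:=-\lambda\sigma_1^2+\sqrt{\lambda^2\sigma_1^4+\sigma_1^2\sigma_2^2}, \] \[ a_1:=\frac{-\delta\rho+\sqrt{\delta^2\rho^2+4\kappa\rho}}{4},\quad a_3:=\frac{2a_1\rho}{\delta\rho+\lambda\rho+2a_1},\quad a_2:=\frac{a_3(2\rho-a_3)}{2\rho(2\lambda+\delta)},\quad \bar a:=a_3-a_2(2\lambda+\delta)=\frac{a_3^2}{2\rho}. \] Fix $\gamma_{\max}>\gamma^0_\infty$, put $M_0:=\gamma_{\max}^2\,\bar a/\delta$, assume $M_0\in c'([0,\infty))$, and let $h_{\max}:=(c')^{-1}(M_0)\in[0,\infty)$. Let $\mathcal A$ be the set of Borel-measurable functions $h:[0,\infty)\to[0,h_{\max}]$. Let $\gamma\in[0,\gamma_{\max}]$.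 Then for every $h\in\mathcal A$ there is a unique locally absolutely continuous $\gamma^{h}:[0,\infty)\to\mathbb R$ with $\gamma^{h}_0=\gamma$ and $\frac{\mathrm d}{\mathrm dt}\gamma^{h}_t=f(\gamma^{h}_t,h_t)$ for almost every $t\ge 0$; it takes values in $[0,\gamma_{\max}]$, and $t\mapsto e^{-\delta t}\bigl(\bar a\,\gamma^{h}_t+c(h_t)\bigr)$ is integrable on $[0,\infty)$. Moreover, with \[ \mathcal J(h;\gamma):=\int_0^\infty e^{-\delta t}\bigl(\bar a\,\gamma^{h}_t+c(h_t)\bigr)\,\mathrm dt, \qquad v(\gamma):=\inf_{h\in\mathcal A}\mathcal J(h;\gamma), \] there exists a continuous $h^*\in\mathcal A$ that is optimal, i.e. $\mathcal J(h^*;\gamma)=v(\gamma)$. -/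

import Mathlib

open Set MeasureTheory

noncomputable section

/-- The data of the reduced problem: speed of mean reversion `lam`, volatilities `sigma1`, `sigma2`,
cost coefficients `kappa`, `rho` for state and control, discount rate `delta`, the upper bound
`gammaMax` of the conditional variance, and the cost `c` of information acquisition, of which only
the values on `[0, ∞)` matter. -/
structure Model where
  lam : ℝ
  sigma1 : ℝ
  sigma2 : ℝ
  kappa : ℝ
  rho : ℝ
  delta : ℝ
  gammaMax : ℝ
  c : ℝ → ℝ

namespace Model

/-- The stable equilibrium of the uncontrolled conditional variance. -/
def gammaInf (p : Model) : ℝ :=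
  -p.lam * p.sigma1 ^ 2 + √(p.lam ^ 2 * p.sigma1 ^ 4 + p.sigma1 ^ 2 * p.sigma2 ^ 2)

/-- The drift `f(γ, h)` of the conditional variance. -/
def f (p : Model) (g h : ℝ) : ℝ :=
  -((1 / p.sigma1) ^ 2 + h) * g ^ 2 - 2 * p.lam * g + p.sigma2 ^ 2

def a1 (p : Model) : ℝ :=
  -(p.delta * p.rho) / 4 + √(p.delta ^ 2 * p.rho ^ 2 + 4 * p.kappa * p.rho) / 4

def a3 (p : Model) : ℝ :=
  2 * p.a1 * p.rho / (p.delta * p.rho + p.lam * p.rho + 2 * p.a1)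

def a2 (p : Model) : ℝ :=
  p.a3 * (2 * p.rho - p.a3) / (2 * p.rho * (2 * p.lam + p.delta))

def aBar (p : Model) : ℝ := p.a3 - p.a2 * (2 * p.lam + p.delta)

/-- The marginal cost `c'` on `[0, ∞)` (one-sided at `0`). -/
def cDeriv (p : Model) : ℝ → ℝ := derivWithin p.c (Ici 0)

def M0 (p : Model) : ℝ := p.gammaMax ^ 2 * (p.aBar / p.delta)

/-- `hMax = (c')⁻¹(M₀)`, where `c'` is regarded as a function on `[0, ∞)`;
meaningful if `M₀ ∈ c'([0, ∞))`. -/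
def hMax (p : Model) : ℝ := Function.invFunOn p.cDeriv (Ici 0) p.M0

/-- The Borel-measurable controls `h : [0, ∞) → [0, hMax]`; values at negative times are ignored. -/
def controls (p : Model) : Set (ℝ → ℝ) :=
  {h | Measurable ((Ici (0 : ℝ)).domRestrict h) ∧ MapsTo h (Ici 0) (Icc 0 p.hMax)}

/-- `g` is a (locally) absolutely continuous solution on `[0, ∞)` of the state equation
`dγ_t = f(γ_t, h_t) dt`, `γ_0 = g0`, the equation holding at almost every time. -/
structure IsState (p : Model) (h : ℝ → ℝ) (g0 : ℝ) (g : ℝ → ℝ) : Prop where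
  absCont : ∀ T : ℝ, 0 ≤ T → AbsolutelyContinuousOnInterval g 0 T
  init : g 0 = g0
  ode : ∀ᵐ t ∂(volume.restrict (Ici (0 : ℝ))), HasDerivAt g (p.f (g t) (h t)) t

/-- The state `γ^{h; g0}`: the solution of the state equation. -/
def state (p : Model) (h : ℝ → ℝ) (g0 : ℝ) : ℝ → ℝ :=
  Classical.epsilon (p.IsState h g0)

/-- The running cost `k`. -/
def k (p : Model) (g h : ℝ) : ℝ := p.aBar * g + p.c h

/-- The discounted running cost along the state with control `h` and initial value `g0`. -/
def discountedCost (p : Model) (h : ℝ → ℝ) (g0 t : ℝ) : ℝ :=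
  Real.exp (-p.delta * t) * p.k (p.state h g0 t) (h t)

/-- The cost functional of the reduced problem. -/
def costJ (p : Model) (h : ℝ → ℝ) (g0 : ℝ) : ℝ :=
  ∫ t in Ici (0 : ℝ), p.discountedCost h g0 t

/-- The value function of the reduced problem. -/
def value (p : Model) (g0 : ℝ) : ℝ := sInf ((fun h => p.costJ h g0) '' p.controls)

/-- `h` is an optimal control for the initial value `g0`. -/
def IsOptimal (p : Model) (g0 : ℝ) (h : ℝ → ℝ) : Prop :=
  h ∈ p.controls ∧ p.costJ h g0 = p.value g0

end Model

end

/-! The control enters the Riccati drift linearly, and for positive states the reciprocal `u = 1 /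
γ` solves `u' = (1 / σ₁)² + h + 2 λ u - σ₂² u²`, whose right-hand side is jointly concave in `(u,
h)`. Hence `u` is concave in the control, and the state at a midpoint control lies below the
harmonic, a fortiori the arithmetic, mean of the two states (`state_midpoint_le`). Since `aBar ≥ 0`
and `c` is strictly convex, the cost functional is strictly midpoint convex, with a gap controlled
by that of `c` (`costJ_midpoint_add_le`).

Existence then needs no weak compactness: near-optimal controls are close in `L¹(e^{-δt} dt)`, so a
suitable minimizing sequence converges almost everywhere, and the cost passes to the limit by
dominated convergence (`exists_isOptimal`).

For continuity, a nonnegative adjoint `π` is built explicitly (`exists_isAdjoint`). As the drift is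
concave in the state, `π` bounds cost differences from above (`costJ_sub_costJ_le`); convex
perturbations of an optimal `h` turn this into an integrated maximum principle. Testing it with the
unique minimizer of `x ↦ c x - m x` on `[0, hMax]`, where `m = e^{δt} π γ²`, shows that `h` equals
this minimizer almost everywhere. The minimizer depends continuously on `m`, and `m` is continuous
in time. -/

open scoped Topology

/-! ### Calculus and comparison for locally absolutely continuous functions. -/

/-- `G` is locally absolutely continuous on `[0, ∞)` with almost everywhere derivative `G'`. -/
structure IsPrimitiveOnIci (G G' : ℝ → ℝ) : Prop where
  absCont : ∀ T : ℝ, 0 ≤ T → AbsolutelyContinuousOnInterval G 0 T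
  deriv : ∀ᵐ t ∂(volume.restrict (Ici (0 : ℝ))), HasDerivAt G (G' t) t

/-- An absolutely continuous function is bounded on its interval, and `φ` is Lipschitz on a compact
interval containing its values; the Lipschitz constant passes through the defining sums. -/
theorem AbsolutelyContinuousOnInterval.contDiff_comp {f φ : ℝ → ℝ} {a b : ℝ}
    (hf : AbsolutelyContinuousOnInterval f a b) (hφ : ContDiff ℝ 1 φ) :
    AbsolutelyContinuousOnInterval (fun t => φ (f t)) a b := by
  obtain ⟨C, hC⟩ := hf.exists_bound
  obtain ⟨K, hK⟩ := (hφ.contDiffOn (s := Icc (-C) C)).exists_lipschitzOnWith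
    (by decide) (convex_Icc _ _) isCompact_Icc
  have hmem : ∀ x ∈ uIcc a b, f x ∈ Icc (-C) C := fun x hx => abs_le.1 (hC x hx)
  unfold AbsolutelyContinuousOnInterval at hf ⊢
  refine squeeze_zero' (g := fun E => (K : ℝ) * ∑ i ∈ Finset.range E.1,
    dist (f (E.2 i).1) (f (E.2 i).2)) ?_ ?_ (by simpa using hf.const_mul (K : ℝ))
  · exact Filter.Eventually.of_forall fun E => Finset.sum_nonneg fun i _ => dist_nonneg
  · refine Filter.eventually_inf_principal.2 (Filter.Eventually.of_forall fun E hE => ?_)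
    rw [Finset.mul_sum]
    exact Finset.sum_le_sum fun i hi =>
      hK.dist_le_mul _ (hmem _ (hE.1 i hi).1) _ (hmem _ (hE.1 i hi).2)

namespace IsPrimitiveOnIci

variable {F F' G G' : ℝ → ℝ}

theorem congr_deriv (hG : IsPrimitiveOnIci G F')
    (h : ∀ᵐ t ∂(volume.restrict (Ici (0 : ℝ))), F' t = G' t) : IsPrimitiveOnIci G G' := by
  refine ⟨hG.absCont, ?_⟩
  filter_upwards [hG.deriv, h] with t h1 h2
  rwa [← h2]

theorem add (hF : IsPrimitiveOnIci F F') (hG : IsPrimitiveOnIci G G') :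
    IsPrimitiveOnIci (fun t => F t + G t) (fun t => F' t + G' t) := by
  refine ⟨fun T hT => (hF.absCont T hT).fun_add (hG.absCont T hT), ?_⟩
  filter_upwards [hF.deriv, hG.deriv] with t h1 h2 using h1.add h2

theorem sub (hF : IsPrimitiveOnIci F F') (hG : IsPrimitiveOnIci G G') :
    IsPrimitiveOnIci (fun t => F t - G t) (fun t => F' t - G' t) := by
  refine ⟨fun T hT => (hF.absCont T hT).fun_sub (hG.absCont T hT), ?_⟩
  filter_upwards [hF.deriv, hG.deriv] with t h1 h2 using h1.sub h2

theorem mul (hF : IsPrimitiveOnIci F F') (hG : IsPrimitiveOnIci G G') :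
    IsPrimitiveOnIci (fun t => F t * G t) (fun t => F' t * G t + F t * G' t) := by
  refine ⟨fun T hT => (hF.absCont T hT).fun_mul (hG.absCont T hT), ?_⟩
  filter_upwards [hF.deriv, hG.deriv] with t h1 h2 using h1.mul h2

theorem contDiff_comp (hG : IsPrimitiveOnIci G G') {φ φ' : ℝ → ℝ} (hφ : ContDiff ℝ 1 φ)
    (hφ' : ∀ x, HasDerivAt φ (φ' x) x) :
    IsPrimitiveOnIci (fun t => φ (G t)) (fun t => φ' (G t) * G' t) := by
  refine ⟨fun T hT => (hG.absCont T hT).contDiff_comp hφ, ?_⟩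
  filter_upwards [hG.deriv] with t h1 using (hφ' (G t)).comp t h1

theorem of_contDiff (hG : ContDiff ℝ 1 G) (hG' : ∀ t, HasDerivAt G (G' t) t) :
    IsPrimitiveOnIci G G' :=
  ⟨fun _ _ => hG.contDiffOn.absolutelyContinuousOnInterval, Filter.Eventually.of_forall hG'⟩

theorem const (a : ℝ) : IsPrimitiveOnIci (fun _ => a) (fun _ => 0) :=
  of_contDiff contDiff_const fun t => hasDerivAt_const t a

theorem exp_mul (a : ℝ) :
    IsPrimitiveOnIci (fun t => Real.exp (a * t)) (fun t => a * Real.exp (a * t)) :=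
  of_contDiff (by fun_prop) fun t => by
    simpa [mul_comm] using ((hasDerivAt_id t).const_mul a).exp

theorem const_mul (a : ℝ) (hG : IsPrimitiveOnIci G G') :
    IsPrimitiveOnIci (fun t => a * G t) (fun t => a * G' t) := by
  refine ⟨fun T hT => (hG.absCont T hT).const_mul a, ?_⟩
  filter_upwards [hG.deriv] with t h1 using h1.const_mul a

theorem integral {φ : ℝ → ℝ} (hφ : LocallyIntegrable φ volume) :
    IsPrimitiveOnIci (fun t => ∫ s in (0 : ℝ)..t, φ s) φ := by
  refine ⟨fun T hT => ?_, ?_⟩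
  · refine IntervalIntegrable.absolutelyContinuousOnInterval_intervalIntegral ?_ left_mem_uIcc
    exact intervalIntegrable_iff.mpr
      ((hφ.integrableOn_isCompact isCompact_uIcc).mono_set uIoc_subset_uIcc)
  · filter_upwards [ae_restrict_of_ae (_root_.LocallyIntegrable.ae_hasDerivAt_integral hφ)] with t ht using ht 0

theorem continuousOn (hG : IsPrimitiveOnIci G G') : ContinuousOn G (Ici 0) := by
  intro t ht
  have h0 : (0 : ℝ) ≤ t + 1 := by have := mem_Ici.1 ht; linarith
  have h := (hG.absCont (t + 1) h0).continuousOn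
  rw [uIcc_of_le h0] at h
  refine (h t ⟨ht, by linarith⟩).mono_of_mem_nhdsWithin ?_
  filter_upwards [self_mem_nhdsWithin, mem_nhdsWithin_of_mem_nhds (Iio_mem_nhds (lt_add_one t))]
    with s hs hs' using ⟨hs, le_of_lt hs'⟩

theorem absCont_interval (hG : IsPrimitiveOnIci G G') {a b : ℝ} (ha : 0 ≤ a) (hb : 0 ≤ b) :
    AbsolutelyContinuousOnInterval G a b :=
  (hG.absCont (max a b) (ha.trans (le_max_left _ _))).mono
    (by rw [uIcc_of_le (ha.trans (le_max_left _ _))]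
        exact fun x hx => ⟨(le_min ha hb).trans hx.1, hx.2⟩)

theorem ae_deriv_eq (hG : IsPrimitiveOnIci G G') {a b : ℝ} (ha : 0 ≤ a) (hb : 0 ≤ b) :
    ∀ᵐ t, t ∈ uIoc a b → _root_.deriv G t = G' t := by
  filter_upwards [(ae_restrict_iff' measurableSet_Ici).1 hG.deriv] with t ht hmem
  exact (ht (mem_Ici.2 ((le_min ha hb).trans hmem.1.le))).deriv

theorem intervalIntegrable (hG : IsPrimitiveOnIci G G') {a b : ℝ} (ha : 0 ≤ a) (hb : 0 ≤ b) :
    IntervalIntegrable G' volume a b :=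
  (hG.absCont_interval ha hb).intervalIntegrable_deriv.congr_ae
    ((ae_restrict_iff' measurableSet_uIoc).2 (hG.ae_deriv_eq ha hb))

theorem integral_eq (hG : IsPrimitiveOnIci G G') {a b : ℝ} (ha : 0 ≤ a) (hb : 0 ≤ b) :
    ∫ t in a..b, G' t = G b - G a := by
  rw [← (hG.absCont_interval ha hb).integral_deriv_eq_sub]
  refine intervalIntegral.integral_congr_ae ?_
  filter_upwards [hG.ae_deriv_eq ha hb] with t ht h using (ht h).symm

/-- After the last time `r` with `G r ≥ 0` the function is negative, so its derivative is
nonnegative there and it cannot have dropped below `G r`. Asking for the sign only where `G < 0` is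
what makes this usable as a barrier argument. -/
theorem nonneg_of_deriv_nonneg (hG : IsPrimitiveOnIci G G') {T : ℝ} (h0 : 0 ≤ G 0)
    (h : ∀ᵐ t ∂(volume.restrict (Ici (0 : ℝ))), t ≤ T → G t < 0 → 0 ≤ G' t)
    {t : ℝ} (ht : 0 ≤ t) (htT : t ≤ T) : 0 ≤ G t := by
  by_contra! hneg
  have hc : ContinuousOn G (Icc 0 t) := hG.continuousOn.mono fun s hs => hs.1
  have hcpt : IsCompact (Icc 0 t ∩ G ⁻¹' Ici 0) :=
    isCompact_Icc.of_isClosed_subset (hc.preimage_isClosed_of_isClosed isClosed_Icc isClosed_Ici)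
      inter_subset_left
  have hne : (Icc 0 t ∩ G ⁻¹' Ici 0).Nonempty := ⟨0, ⟨le_rfl, ht⟩, h0⟩
  obtain ⟨⟨hr0, hrt⟩, hr⟩ := hcpt.sSup_mem hne
  set r := sSup (Icc 0 t ∩ G ⁻¹' Ici 0)
  have hlt : ∀ s, r < s → s ≤ t → G s < 0 := by
    intro s hs hst
    by_contra! hs'
    exact absurd (le_csSup hcpt.bddAbove ⟨⟨hr0.trans hs.le, hst⟩, hs'⟩) (not_le.2 hs)
  have hint : 0 ≤ ∫ s in r..t, G' s := by
    rw [intervalIntegral.integral_of_le hrt]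
    refine setIntegral_nonneg_of_ae_restrict ?_
    rw [Filter.EventuallyLE, ae_restrict_iff' measurableSet_Ioc]
    filter_upwards [(ae_restrict_iff' measurableSet_Ici).1 h] with s hs hmem
    exact hs (hr0.trans hmem.1.le) (hmem.2.trans htT) (hlt s hmem.1 hmem.2)
  rw [hG.integral_eq hr0 ht] at hint
  have : 0 ≤ G r := hr
  linarith

/-- A comparison principle: a function satisfying `G' ≥ K G` wherever it is negative stays
nonnegative. -/
theorem nonneg_of_le_deriv (hG : IsPrimitiveOnIci G G') {T : ℝ} (K : ℝ) (h0 : 0 ≤ G 0)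
    (h : ∀ᵐ t ∂(volume.restrict (Ici (0 : ℝ))), t ≤ T → G t < 0 → K * G t ≤ G' t)
    {t : ℝ} (ht : 0 ≤ t) (htT : t ≤ T) : 0 ≤ G t := by
  -- The integrating factor `e^{-Kt}` keeps the sign of `G` and removes the linear term.
  have := ((exp_mul (-K)).mul hG).nonneg_of_deriv_nonneg (T := T) (by simpa using h0) ?_ ht htT
  · exact nonneg_of_mul_nonneg_right this (Real.exp_pos _)
  · filter_upwards [h] with s hs hsT hneg
    have := hs hsT (by
      by_contra! hcon
      exact absurd (mul_nonneg (Real.exp_pos (-K * s)).le hcon) (not_le.2 hneg))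
    have h2 := mul_le_mul_of_nonneg_left this (Real.exp_pos (-K * s)).le
    linarith

end IsPrimitiveOnIci

/-! ### Carathéodory equations on the half-line. -/

theorem locallyIntegrable_of_measurable_of_bound {φ : ℝ → ℝ} (hφ : Measurable φ) {B : ℝ}
    (hB : ∀ s, |φ s| ≤ B) : LocallyIntegrable φ volume := by
  refine (locallyIntegrable_const B).mono hφ.aestronglyMeasurable ?_
  exact Filter.Eventually.of_forall fun s => (hB s).trans (le_abs_self B)

theorem intervalIntegrable_of_measurable_of_bound {φ : ℝ → ℝ} (hφ : Measurable φ) {B : ℝ}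
    (hB : ∀ s, |φ s| ≤ B) (a b : ℝ) : IntervalIntegrable φ volume a b :=
  intervalIntegrable_iff.mpr (((locallyIntegrable_of_measurable_of_bound hφ hB)
    |>.integrableOn_isCompact isCompact_uIcc).mono_set uIoc_subset_uIcc)

/-- Global existence for a Carathéodory differential equation with bounded, uniformly Lipschitz
right-hand side. -/
theorem exists_isPrimitiveOnIci_of_lipschitz {φ : ℝ → ℝ → ℝ} {L B : ℝ} (hL : 0 < L)
    (hmeas : ∀ g : ℝ → ℝ, Continuous g → Measurable fun s => φ s (g s))
    (hbd : ∀ s x, |φ s x| ≤ B) (hlip : ∀ s x y, |φ s x - φ s y| ≤ L * |x - y|) (x₀ : ℝ) :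
    ∃ G : ℝ → ℝ, G 0 = x₀ ∧ IsPrimitiveOnIci G fun t => φ t (G t) := by
  have hB : 0 ≤ B := (abs_nonneg _).trans (hbd 0 0)
  -- Picard iteration for `u = G / w`: the exponential weight keeps `u` bounded on the half-line and
  -- makes the integral operator a contraction globally, so no local solutions have to be glued.
  let w : ℝ → ℝ := fun s => Real.exp (2 * L * s)
  have hw : Continuous w := by fun_prop
  let I : BoundedContinuousFunction ℝ ℝ → ℝ → ℝ :=
    fun u t => ∫ s in (0 : ℝ)..t, φ s (w s * u s)
  have hm : ∀ u : BoundedContinuousFunction ℝ ℝ, Measurable fun s => φ s (w s * u s) :=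
    fun u => hmeas _ (hw.mul u.continuous)
  have hint : ∀ (u : BoundedContinuousFunction ℝ ℝ) (a b : ℝ),
      IntervalIntegrable (fun s => φ s (w s * u s)) volume a b := fun u a b =>
    intervalIntegrable_of_measurable_of_bound (hm u) (fun s => hbd s _) a b
  have hI : ∀ u, Continuous (I u) := fun u =>
    intervalIntegral.continuous_primitive (fun a b => hint u a b) 0
  -- `max t 0` freezes the operator at its initial value for negative times, so that it acts on
  -- functions on the whole line.
  let Φ : BoundedContinuousFunction ℝ ℝ → ℝ → ℝ :=
    fun u t => Real.exp (-(2 * L * max t 0)) * (x₀ + I u (max t 0))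
  have hΦc : ∀ u, Continuous (Φ u) := fun u => by
    have := (hI u).comp (continuous_id.max (continuous_const (y := (0 : ℝ))))
    exact (Real.continuous_exp.comp (by fun_prop)).mul (continuous_const.add this)
  have hΦb : ∀ u t, ‖Φ u t‖ ≤ |x₀| + B / (2 * L) := by
    intro u t
    have ht : 0 ≤ max t 0 := le_max_right _ _
    set r := max t 0
    have h1 : |I u r| ≤ B * r := by
      have := intervalIntegral.norm_integral_le_of_norm_le_const (a := 0) (b := r) (C := B)
        (f := fun s => φ s (w s * u s)) fun s _ => hbd s _
      simpa [abs_of_nonneg ht] using this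
    have h2 : 2 * L * r + 1 ≤ Real.exp (2 * L * r) := Real.add_one_le_exp _
    have h3 : Real.exp (-(2 * L * r)) ≤ 1 := Real.exp_le_one_iff.2 (by
      have := mul_nonneg hL.le ht; linarith)
    have h4 : Real.exp (-(2 * L * r)) * Real.exp (2 * L * r) = 1 := by
      rw [← Real.exp_add]; simp
    have h5 : Real.exp (-(2 * L * r)) * r ≤ 1 / (2 * L) := by
      rw [le_div_iff₀ (by positivity)]
      have := mul_le_mul_of_nonneg_left h2 (Real.exp_pos (-(2 * L * r))).le
      have := (Real.exp_pos (-(2 * L * r))).le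
      linarith
    rw [Real.norm_eq_abs, abs_mul, abs_of_pos (Real.exp_pos _)]
    calc Real.exp (-(2 * L * r)) * |x₀ + I u r|
        ≤ Real.exp (-(2 * L * r)) * (|x₀| + B * r) :=
          mul_le_mul_of_nonneg_left ((abs_add_le _ _).trans (by linarith)) (Real.exp_pos _).le
      _ = Real.exp (-(2 * L * r)) * |x₀| + B * (Real.exp (-(2 * L * r)) * r) := by ring
      _ ≤ 1 * |x₀| + B * (1 / (2 * L)) := by gcongr
      _ = _ := by ring
  let Ψ : BoundedContinuousFunction ℝ ℝ → BoundedContinuousFunction ℝ ℝ := fun u =>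
    BoundedContinuousFunction.ofNormedAddCommGroup (Φ u) (hΦc u) _ (hΦb u)
  have hcontr : ContractingWith (1 / 2) Ψ := by
    refine ⟨by norm_num, LipschitzWith.of_dist_le_mul fun u v => ?_⟩
    have hnn : (0 : ℝ) ≤ ((1 / 2 : NNReal) : ℝ) * dist u v := by positivity
    refine (BoundedContinuousFunction.dist_le hnn).2 fun t => ?_
    have ht : 0 ≤ max t 0 := le_max_right _ _
    change |Φ u t - Φ v t| ≤ _
    have hΦe : Φ u t - Φ v t =
        Real.exp (-(2 * L * max t 0)) * (I u (max t 0) - I v (max t 0)) := by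
      simp only [Φ]; ring
    rw [hΦe]
    set r := max t 0
    -- The contraction factor `1 / 2` is the ratio of the Lipschitz constant `L` to the weight's
    -- rate `2 * L`.
    have h1 : |I u r - I v r| ≤ (w r - 1) / 2 * dist u v := by
      have e1 : I u r - I v r = ∫ s in (0 : ℝ)..r, (φ s (w s * u s) - φ s (w s * v s)) :=
        (intervalIntegral.integral_sub (hint u 0 r) (hint v 0 r)).symm
      have e2 : ∫ s in (0 : ℝ)..r, L * (w s * dist u v) = (w r - 1) / 2 * dist u v := by
        have : ∀ s ∈ uIcc 0 r, HasDerivAt (fun s => w s / 2 * dist u v)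
            (L * (w s * dist u v)) s := fun s _ => by
          have := ((hasDerivAt_id s).const_mul (2 * L)).exp
          refine ((this.div_const 2).mul_const (dist u v)).congr_deriv ?_
          simp only [w, id]; ring
        rw [intervalIntegral.integral_eq_sub_of_hasDerivAt this
          (Continuous.intervalIntegrable (by fun_prop) _ _)]
        simp [w]; ring
      rw [e1, ← e2, ← Real.norm_eq_abs]
      refine intervalIntegral.norm_integral_le_of_norm_le ht
        (Filter.Eventually.of_forall fun s _ => ?_)
        (Continuous.intervalIntegrable (by fun_prop) _ _)
      rw [Real.norm_eq_abs]
      refine (hlip s _ _).trans (mul_le_mul_of_nonneg_left ?_ hL.le)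
      rw [← mul_sub, abs_mul, abs_of_pos (Real.exp_pos _)]
      exact mul_le_mul_of_nonneg_left (u.dist_coe_le_dist s) (Real.exp_pos _).le
    rw [abs_mul, abs_of_pos (Real.exp_pos _)]
    have h4 : Real.exp (-(2 * L * r)) * w r = 1 := by
      rw [← Real.exp_add]; simp
    calc Real.exp (-(2 * L * r)) * |I u r - I v r|
        ≤ Real.exp (-(2 * L * r)) * ((w r - 1) / 2 * dist u v) :=
          mul_le_mul_of_nonneg_left h1 (Real.exp_pos _).le
      _ = (Real.exp (-(2 * L * r)) * w r - Real.exp (-(2 * L * r))) / 2 * dist u v := by ring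
      _ ≤ _ := by
        rw [h4]
        push_cast
        gcongr
        linarith [Real.exp_pos (-(2 * L * r))]
  set u := ContractingWith.fixedPoint Ψ hcontr
  have hu : ∀ t, 0 ≤ t → w t * u t = x₀ + I u t := by
    intro t ht
    have h1 : u t = Φ u t := by
      have := hcontr.fixedPoint_isFixedPt
      exact congrArg (fun z : BoundedContinuousFunction ℝ ℝ => z t) this.symm
    rw [h1]
    simp only [Φ, max_eq_left ht, w]
    rw [← mul_assoc, ← Real.exp_add]
    simp
  refine ⟨fun t => x₀ + I u t, by simp [I], ?_⟩
  have hp := (IsPrimitiveOnIci.const x₀).add (IsPrimitiveOnIci.integral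
    (locallyIntegrable_of_measurable_of_bound (hm u) fun s => hbd s _))
  refine hp.congr_deriv ?_
  filter_upwards [ae_restrict_mem measurableSet_Ici] with t ht
  rw [← hu t ht, zero_add]

theorem AbsolutelyContinuousOnInterval.congr {f g : ℝ → ℝ} {a b : ℝ}
    (hf : AbsolutelyContinuousOnInterval f a b) (h : EqOn f g (uIcc a b)) :
    AbsolutelyContinuousOnInterval g a b := by
  unfold AbsolutelyContinuousOnInterval at hf ⊢
  refine hf.congr' (Filter.eventually_inf_principal.2 (Filter.Eventually.of_forall fun E hE => ?_))
  exact Finset.sum_congr rfl fun i hi => by rw [h (hE.1 i hi).1, h (hE.1 i hi).2]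

theorem ae_restrict_Ici_pos : ∀ᵐ t ∂(volume.restrict (Ici (0 : ℝ))), 0 < t := by
  rw [← restrict_Ioi_eq_restrict_Ici]
  exact ae_restrict_mem measurableSet_Ioi

namespace IsPrimitiveOnIci

theorem congr {F G F' : ℝ → ℝ} (hF : IsPrimitiveOnIci F F') (h : EqOn F G (Ici 0)) :
    IsPrimitiveOnIci G F' := by
  refine ⟨fun T hT => (hF.absCont T hT).congr (h.mono ?_), ?_⟩
  · rw [uIcc_of_le hT]
    exact fun x hx => hx.1
  -- The derivative is two-sided while the functions agree only on `[0, ∞)`, so the null set `{0}`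
  -- is discarded.
  · filter_upwards [hF.deriv, ae_restrict_Ici_pos] with t ht h0
    refine ht.congr_of_eventuallyEq ?_
    filter_upwards [Ioi_mem_nhds h0] with s hs using (h (mem_Ici.2 (le_of_lt hs))).symm

theorem integral_of_bound {ψ : ℝ → ℝ} {B : ℝ}
    (hψ : AEStronglyMeasurable ψ (volume.restrict (Ici 0))) (hB : ∀ t, 0 ≤ t → |ψ t| ≤ B) :
    IsPrimitiveOnIci (fun t => ∫ s in (0 : ℝ)..t, ψ s) ψ := by
  have hl : LocallyIntegrable ((Ici 0).indicator ψ) volume := by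
    refine (locallyIntegrable_const B).mono
      ((aestronglyMeasurable_indicator_iff measurableSet_Ici).2 hψ) ?_
    refine Filter.Eventually.of_forall fun s => ?_
    have hB0 : 0 ≤ B := (abs_nonneg _).trans (hB 0 le_rfl)
    by_cases hs : s ∈ Ici (0 : ℝ)
    · rw [indicator_of_mem hs]
      exact (hB s hs).trans (le_abs_self B)
    · rw [indicator_of_notMem hs]
      simp
  refine ((integral hl).congr fun t ht => ?_).congr_deriv ?_
  · refine intervalIntegral.integral_congr fun s hs => ?_
    rw [uIcc_of_le ht] at hs
    exact indicator_of_mem (mem_Ici.2 hs.1) _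
  · filter_upwards [ae_restrict_mem measurableSet_Ici] with t ht using indicator_of_mem ht _

end IsPrimitiveOnIci

/-! ### The state equation: well-posedness, stability, convexity in the control. -/

namespace Model

/-- The standing assumptions in the form in which they are used. -/
structure Regular (p : Model) : Prop where
  lam_nonneg : 0 ≤ p.lam
  delta_pos : 0 < p.delta
  aBar_nonneg : 0 ≤ p.aBar
  gammaMax_pos : 0 < p.gammaMax
  hMax_nonneg : 0 ≤ p.hMax
  drift_gammaMax : p.f p.gammaMax 0 ≤ 0
  strictConvexOn : StrictConvexOn ℝ (Ici 0) p.c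
  continuousOn : ContinuousOn p.c (Ici 0)

variable {p : Model} {h k : ℝ → ℝ}

theorem aestronglyMeasurable_of_mem_controls (hh : h ∈ p.controls) :
    AEStronglyMeasurable h (volume.restrict (Ici 0)) :=
  (aemeasurable_restrict_of_measurable_subtype measurableSet_Ici hh.1).aestronglyMeasurable

theorem measurable_comp_max_of_mem_controls (hh : h ∈ p.controls) :
    Measurable fun t : ℝ => h (max t 0) :=
  hh.1.comp ((measurable_id.max measurable_const).subtype_mk
    (h := fun t => mem_Ici.2 (le_max_right t 0)))

theorem add_mul_sub_mem_controls (hh : h ∈ p.controls) (hk : k ∈ p.controls) {θ : ℝ}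
    (hθ : θ ∈ Icc (0 : ℝ) 1) : (fun t => h t + θ * (k t - h t)) ∈ p.controls := by
  refine ⟨hh.1.add ((hk.1.sub hh.1).const_mul θ), fun t ht => ?_⟩
  obtain ⟨h1, h2⟩ := hh.2 ht
  obtain ⟨h3, h4⟩ := hk.2 ht
  obtain ⟨h5, h6⟩ := hθ
  constructor <;> simp only <;> nlinarith

theorem midpoint_mem_controls (hh : h ∈ p.controls) (hk : k ∈ p.controls) :
    (fun t => (h t + k t) / 2) ∈ p.controls := by
  convert add_mul_sub_mem_controls hh hk (θ := 1 / 2) (by norm_num) using 2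
  ring

namespace IsState

theorem isPrimitiveOnIci {g₀ : ℝ} {g : ℝ → ℝ} (hg : p.IsState h g₀ g) :
    IsPrimitiveOnIci g fun t => p.f (g t) (h t) :=
  ⟨hg.absCont, hg.ode⟩

theorem of_isPrimitiveOnIci {g : ℝ → ℝ} (hg : IsPrimitiveOnIci g fun t => p.f (g t) (h t)) :
    p.IsState h (g 0) g :=
  ⟨hg.absCont, rfl, hg.deriv⟩

theorem congr_control {g₀ : ℝ} {g : ℝ → ℝ} (hg : p.IsState h g₀ g)
    (hhk : h =ᵐ[volume.restrict (Ici 0)] k) : p.IsState k g₀ g := by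
  refine ⟨hg.absCont, hg.init, ?_⟩
  filter_upwards [hg.ode, hhk] with t ht he
  rwa [← he]

end IsState

/-- Truncating the state to `[0, gammaMax]` makes the drift bounded and Lipschitz. The drift is `σ₂²
≥ 0` at `0` and at most `f(gammaMax, 0) ≤ 0` at `gammaMax`, so the truncated solution never leaves
the interval and solves the original equation. -/
theorem exists_isState (hp : p.Regular) (hh : h ∈ p.controls) {g₀ : ℝ}
    (hg₀ : g₀ ∈ Icc 0 p.gammaMax) :
    ∃ g, p.IsState h g₀ g ∧ MapsTo g (Ici 0) (Icc 0 p.gammaMax) := by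
  have hM := hp.gammaMax_pos
  set M := p.gammaMax
  set s := (1 / p.sigma1) ^ 2 with hs
  have hs0 : 0 ≤ s := by positivity
  have hH := hp.hMax_nonneg
  have hlam := hp.lam_nonneg
  let cl : ℝ → ℝ := fun x => max 0 (min M x)
  have hcl : ∀ x, cl x ∈ Icc 0 M := fun x =>
    ⟨le_max_left _ _, max_le hM.le (min_le_left _ _)⟩
  have hcl_lip : ∀ x y, |cl x - cl y| ≤ |x - y| := fun x y =>
    (abs_max_sub_max_le_max _ _ _ _).trans (max_le (by simp) ((abs_min_sub_min_le_max _ _ _ _).trans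
      (max_le (by simp) le_rfl)))
  have hbd : ∀ t, h (max t 0) ∈ Icc 0 p.hMax := fun t => hh.2 (mem_Ici.2 (le_max_right t 0))
  obtain ⟨G, hG0, hG⟩ := exists_isPrimitiveOnIci_of_lipschitz
    (φ := fun t x => p.f (cl x) (h (max t 0)))
    (L := (s + p.hMax) * (2 * M) + 2 * p.lam + 1)
    (B := (s + p.hMax) * M ^ 2 + 2 * p.lam * M + p.sigma2 ^ 2) (by positivity)
    (fun g hg => by
      have h1 := measurable_comp_max_of_mem_controls hh
      have h2 : Measurable fun t => cl (g t) :=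
        measurable_const.max (measurable_const.min hg.measurable)
      exact (((measurable_const.add h1).neg.mul (h2.pow_const 2)).sub
        (h2.const_mul (2 * p.lam))).add_const _)
    (fun t x => by
      obtain ⟨h1, h2⟩ := hcl x
      obtain ⟨h3, h4⟩ := hbd t
      have e1 : (s + h (max t 0)) * cl x ^ 2 ≤ (s + p.hMax) * M ^ 2 := by gcongr
      have e2 : 0 ≤ (s + h (max t 0)) * cl x ^ 2 := by positivity
      have e3 : 2 * p.lam * cl x ≤ 2 * p.lam * M := by gcongr
      have e4 : 0 ≤ 2 * p.lam * cl x := by positivity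
      have e5 := sq_nonneg p.sigma2
      unfold f
      rw [abs_le]
      constructor <;> linarith)
    (fun t x y => by
      obtain ⟨h1, h2⟩ := hcl x
      obtain ⟨h1', h2'⟩ := hcl y
      obtain ⟨h3, h4⟩ := hbd t
      have e : p.f (cl x) (h (max t 0)) - p.f (cl y) (h (max t 0)) =
          -((s + h (max t 0)) * (cl x + cl y) + 2 * p.lam) * (cl x - cl y) := by
        unfold f; ring
      rw [e, abs_mul, abs_neg, abs_of_nonneg (by positivity)]
      refine mul_le_mul ?_ (hcl_lip x y) (abs_nonneg _) (by positivity)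
      have : (s + h (max t 0)) * (cl x + cl y) ≤ (s + p.hMax) * (2 * M) := by
        gcongr; linarith
      linarith) g₀
  have hmaps : ∀ t, 0 ≤ t → G t ∈ Icc 0 M := by
    intro t ht
    constructor
    · refine hG.nonneg_of_deriv_nonneg (T := t) (hG0 ▸ hg₀.1) ?_ ht le_rfl
      refine Filter.Eventually.of_forall fun r _ hr => ?_
      have : cl (G r) = 0 := max_eq_left ((min_le_right _ _).trans hr.le)
      simp only [this, f]
      nlinarith [sq_nonneg p.sigma2]
    · have h1 := (IsPrimitiveOnIci.const M).sub hG
      refine sub_nonneg.1 (h1.nonneg_of_deriv_nonneg (T := t) (by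
        rw [hG0]; exact sub_nonneg.2 hg₀.2) ?_ ht le_rfl)
      refine Filter.Eventually.of_forall fun r _ hr => ?_
      have : cl (G r) = M := by
        simp only [cl]
        rw [min_eq_left (by linarith), max_eq_right hM.le]
      have h3 := mul_nonneg (hbd r).1 (sq_nonneg M)
      have h4 := hp.drift_gammaMax
      simp only [this]
      unfold f at h4 ⊢
      linarith
  refine ⟨G, ?_, hmaps⟩
  rw [← hG0]
  refine IsState.of_isPrimitiveOnIci (hG.congr_deriv ?_)
  filter_upwards [ae_restrict_mem measurableSet_Ici] with t ht
  have h1 : cl (G t) = G t := by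
    simp only [cl]
    rw [min_eq_right (hmaps t ht).2, max_eq_right (hmaps t ht).1]
  rw [h1, max_eq_left ht]

/-- Competing solutions are not known to stay in `[0, gammaMax]`, so the Lipschitz constant of the
drift comes from their bounds on `[0, T]`. Comparison is applied to `-(g₁ - g₂)²`, which starts at
zero. -/
theorem IsState.eqOn (hp : p.Regular) (hh : h ∈ p.controls) {g₀ : ℝ} {g₁ g₂ : ℝ → ℝ}
    (h₁ : p.IsState h g₀ g₁) (h₂ : p.IsState h g₀ g₂) : EqOn g₁ g₂ (Ici 0) := by
  intro T hT
  obtain ⟨C₁, hC₁⟩ := (h₁.absCont T hT).exists_bound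
  obtain ⟨C₂, hC₂⟩ := (h₂.absCont T hT).exists_bound
  rw [uIcc_of_le hT] at hC₁ hC₂
  set s := (1 / p.sigma1) ^ 2 with hs
  have hs0 : 0 ≤ s := by positivity
  have hz := h₁.isPrimitiveOnIci.sub h₂.isPrimitiveOnIci
  have hw := (hz.mul hz).const_mul (-1)
  have key := hw.nonneg_of_le_deriv (T := T) (2 * ((s + p.hMax) * (C₁ + C₂) + 2 * p.lam))
    (by simp [h₁.init, h₂.init]) ?_ hT le_rfl
  · have : (g₁ T - g₂ T) ^ 2 ≤ 0 := by linarith [sq (g₁ T - g₂ T)]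
    exact sub_eq_zero.1 (pow_eq_zero_iff two_ne_zero |>.1 (le_antisymm this (sq_nonneg _)))
  · filter_upwards [ae_restrict_mem measurableSet_Ici] with t ht htT _
    have a1 := hC₁ t ⟨ht, htT⟩
    have a2 := hC₂ t ⟨ht, htT⟩
    obtain ⟨b1, b2⟩ := hh.2 ht
    rw [Real.norm_eq_abs] at a1 a2
    have hlam := hp.lam_nonneg
    have a3 : |(s + h t) * (g₁ t + g₂ t)| ≤ (s + p.hMax) * (C₁ + C₂) := by
      rw [abs_mul, abs_of_nonneg (by positivity)]
      have := abs_add_le (g₁ t) (g₂ t)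
      refine mul_le_mul (by linarith) (by linarith) (abs_nonneg _) (by linarith)
    have a4 := (abs_le.1 a3).1
    have a5 : 0 ≤ ((s + p.hMax) * (C₁ + C₂) + 2 * p.lam + ((s + h t) * (g₁ t + g₂ t) + 2 * p.lam))
        * (g₁ t - g₂ t) ^ 2 := mul_nonneg (by linarith) (sq_nonneg _)
    unfold f
    rw [← hs]
    linarith

theorem isState_state (hp : p.Regular) (hh : h ∈ p.controls) {g₀ : ℝ}
    (hg₀ : g₀ ∈ Icc 0 p.gammaMax) : p.IsState h g₀ (p.state h g₀) :=
  Classical.epsilon_spec ((exists_isState hp hh hg₀).imp fun _ hg => hg.1)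

theorem mapsTo_state (hp : p.Regular) (hh : h ∈ p.controls) {g₀ : ℝ}
    (hg₀ : g₀ ∈ Icc 0 p.gammaMax) : MapsTo (p.state h g₀) (Ici 0) (Icc 0 p.gammaMax) := by
  obtain ⟨g, hg, hm⟩ := exists_isState hp hh hg₀
  intro t ht
  rw [(isState_state hp hh hg₀).eqOn hp hh hg ht]
  exact hm ht

/-- Controls equal almost everywhere have the same solution predicate, so `Classical.epsilon`
returns literally the same function. -/
theorem state_congr_control (hhk : h =ᵐ[volume.restrict (Ici 0)] k) (g₀ : ℝ) :
    p.state h g₀ = p.state k g₀ := by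
  have : p.IsState h g₀ = p.IsState k g₀ :=
    funext fun g => propext ⟨fun hg => hg.congr_control hhk, fun hg => hg.congr_control hhk.symm⟩
  rw [state, this, state]

theorem costJ_congr_control (hhk : h =ᵐ[volume.restrict (Ici 0)] k) (g₀ : ℝ) :
    p.costJ h g₀ = p.costJ k g₀ := by
  refine integral_congr_ae ?_
  filter_upwards [hhk] with t ht
  rw [discountedCost, discountedCost, state_congr_control hhk, ht]

theorem abs_sub_le_of_mem_controls (hh : h ∈ p.controls) (hk : k ∈ p.controls) {t : ℝ}
    (ht : 0 ≤ t) : |k t - h t| ≤ p.hMax :=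
  abs_sub_le_iff.2 ⟨by linarith [(hk.2 ht).2, (hh.2 ht).1], by linarith [(hh.2 ht).2, (hk.2 ht).1]⟩

/-- For nonnegative states the drift is nonincreasing in the state, so differences are fed only by
the change of control, at rate at most `gammaMax² |k - h|`; no exponential factor appears. -/
theorem state_sub_state_le (hp : p.Regular) (hh : h ∈ p.controls) (hk : k ∈ p.controls)
    {g₀ g₁ : ℝ} (hg₀ : g₀ ∈ Icc 0 p.gammaMax) (hg₁ : g₁ ∈ Icc 0 p.gammaMax) {t : ℝ}
    (ht : 0 ≤ t) :
    p.state h g₀ t - p.state k g₁ t ≤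
      |g₁ - g₀| + p.gammaMax ^ 2 * ∫ r in (0 : ℝ)..t, |k r - h r| := by
  have hψ : AEStronglyMeasurable (fun r => |k r - h r|) (volume.restrict (Ici 0)) :=
    ((aestronglyMeasurable_of_mem_controls hk).sub
      (aestronglyMeasurable_of_mem_controls hh)).norm
  have hI := IsPrimitiveOnIci.integral_of_bound hψ (B := p.hMax) fun r hr => by
    rw [abs_abs]; exact abs_sub_le_of_mem_controls hh hk hr
  have s₀ := isState_state hp hh hg₀
  have s₁ := isState_state hp hk hg₁
  have m₀ := mapsTo_state hp hh hg₀
  have m₁ := mapsTo_state hp hk hg₁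
  have hD := ((IsPrimitiveOnIci.const |g₁ - g₀|).add (hI.const_mul (p.gammaMax ^ 2))).add
    (s₁.isPrimitiveOnIci.sub s₀.isPrimitiveOnIci)
  have h0 : ∀ r, 0 ≤ r → 0 ≤ p.gammaMax ^ 2 * ∫ u in (0 : ℝ)..r, |k u - h u| := fun r hr =>
    mul_nonneg (sq_nonneg _) (intervalIntegral.integral_nonneg hr fun u _ => abs_nonneg _)
  have key := hD.nonneg_of_deriv_nonneg (T := t) (by
    simp only [s₀.init, s₁.init, intervalIntegral.integral_same]
    linarith [neg_abs_le (g₁ - g₀)]) ?_ ht le_rfl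
  · linarith
  · filter_upwards [ae_restrict_mem measurableSet_Ici] with r hr _ hneg
    obtain ⟨a1, a2⟩ := m₀ hr
    obtain ⟨b1, b2⟩ := m₁ hr
    obtain ⟨c1, c2⟩ := hh.2 hr
    have hlam := hp.lam_nonneg
    have hz : p.state k g₁ r - p.state h g₀ r ≤ 0 := by
      linarith [h0 r hr, abs_nonneg (g₁ - g₀)]
    set x := p.state h g₀ r
    set y := p.state k g₁ r
    have e1 : 0 ≤ (((1 / p.sigma1) ^ 2 + h r) * (x + y) + 2 * p.lam) * (x - y) :=
      mul_nonneg (by positivity) (by linarith)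
    have e2 : (k r - h r) * y ^ 2 ≤ p.gammaMax ^ 2 * |k r - h r| := by
      calc (k r - h r) * y ^ 2 ≤ |k r - h r| * y ^ 2 :=
            mul_le_mul_of_nonneg_right (le_abs_self _) (sq_nonneg _)
        _ ≤ |k r - h r| * p.gammaMax ^ 2 := by gcongr
        _ = _ := mul_comm _ _
    unfold f
    linarith

theorem abs_state_sub_state_le (hp : p.Regular) (hh : h ∈ p.controls) (hk : k ∈ p.controls)
    {g₀ g₁ : ℝ} (hg₀ : g₀ ∈ Icc 0 p.gammaMax) (hg₁ : g₁ ∈ Icc 0 p.gammaMax) {t : ℝ}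
    (ht : 0 ≤ t) :
    |p.state h g₀ t - p.state k g₁ t| ≤
      |g₁ - g₀| + p.gammaMax ^ 2 * ∫ r in (0 : ℝ)..t, |k r - h r| := by
  refine abs_sub_le_iff.2 ⟨state_sub_state_le hp hh hk hg₀ hg₁ ht, ?_⟩
  have := state_sub_state_le hp hk hh hg₁ hg₀ ht
  rw [abs_sub_comm g₁ g₀]
  simpa only [abs_sub_comm (k _)] using this

/-- Below `gammaMax` the quadratic term is dominated by a linear one. The resulting positive lower
bound makes the harmonic-mean argument possible. -/
theorem mul_exp_le_state (hp : p.Regular) (hh : h ∈ p.controls) {g₀ : ℝ}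
    (hg₀ : g₀ ∈ Icc 0 p.gammaMax) {t : ℝ} (ht : 0 ≤ t) :
    g₀ * Real.exp (-(((1 / p.sigma1) ^ 2 + p.hMax) * p.gammaMax + 2 * p.lam) * t) ≤
      p.state h g₀ t := by
  set C := ((1 / p.sigma1) ^ 2 + p.hMax) * p.gammaMax + 2 * p.lam with hC
  have s₀ := isState_state hp hh hg₀
  have hD := s₀.isPrimitiveOnIci.sub ((IsPrimitiveOnIci.exp_mul (-C)).const_mul g₀)
  refine sub_nonneg.1 (hD.nonneg_of_le_deriv (T := t) (-C) (by simp [s₀.init]) ?_ ht le_rfl)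
  filter_upwards [ae_restrict_mem measurableSet_Ici] with r hr _ _
  obtain ⟨a1, a2⟩ := mapsTo_state hp hh hg₀ hr
  obtain ⟨c1, c2⟩ := hh.2 hr
  set x := p.state h g₀ r
  have hH := hp.hMax_nonneg
  have e1 : ((1 / p.sigma1) ^ 2 + h r) * (x * x) ≤
      ((1 / p.sigma1) ^ 2 + p.hMax) * (p.gammaMax * x) := by gcongr
  have e2 := sq_nonneg p.sigma2
  unfold f
  rw [sq x]
  have e3 : C * x = ((1 / p.sigma1) ^ 2 + p.hMax) * (p.gammaMax * x) + 2 * p.lam * x := by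
    rw [hC]; ring
  linarith

/-- With `a`, `b` the two states and `g` the midpoint state, concavity of `1 / γ` in the control
reads `g ≤ 2ab / (a + b)`. Cleared of denominators, this is `D = 2ab - g(a + b) ≥ 0`, which is
proved by comparison. -/
theorem state_midpoint_le_of_pos (hp : p.Regular) (hh : h ∈ p.controls) (hk : k ∈ p.controls)
    {g₀ : ℝ} (hg₀ : g₀ ∈ Icc 0 p.gammaMax) (hpos : 0 < g₀) {T : ℝ} (hT : 0 ≤ T) :
    p.state (fun t => (h t + k t) / 2) g₀ T ≤ (p.state h g₀ T + p.state k g₀ T) / 2 := by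
  have hl := midpoint_mem_controls hh hk
  set l : ℝ → ℝ := fun t => (h t + k t) / 2 with hldef
  have sa := isState_state hp hh hg₀
  have sb := isState_state hp hk hg₀
  have sg := isState_state hp hl hg₀
  set C := ((1 / p.sigma1) ^ 2 + p.hMax) * p.gammaMax + 2 * p.lam with hC
  have hC0 : 0 ≤ C := by
    have := hp.hMax_nonneg
    have := hp.gammaMax_pos
    have := hp.lam_nonneg
    positivity
  set m := g₀ * Real.exp (-C * T) with hm
  have hm0 : 0 < m := by positivity
  have hlow : ∀ t, 0 ≤ t → t ≤ T → m ≤ p.state h g₀ t ∧ m ≤ p.state k g₀ t := by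
    intro t ht htT
    have : m ≤ g₀ * Real.exp (-C * t) := by
      refine mul_le_mul_of_nonneg_left (Real.exp_le_exp.2 ?_) hpos.le
      nlinarith
    exact ⟨this.trans (mul_exp_le_state hp hh hg₀ ht), this.trans (mul_exp_le_state hp hk hg₀ ht)⟩
  have hD := ((sa.isPrimitiveOnIci.mul sb.isPrimitiveOnIci).const_mul 2).sub
    (sg.isPrimitiveOnIci.mul (sa.isPrimitiveOnIci.add sb.isPrimitiveOnIci))
  have key := hD.nonneg_of_le_deriv (T := T) (p.sigma2 ^ 2 / m)
    (by simp only [sa.init, sb.init, sg.init]; linarith) ?_ hT le_rfl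
  · obtain ⟨h1, h2⟩ := hlow T hT le_rfl
    set a := p.state h g₀ T
    set b := p.state k g₀ T
    have h3 : 0 < a + b := by linarith
    refine le_of_mul_le_mul_right ?_ h3
    -- From `D ≥ 0`, the harmonic mean being at most the arithmetic mean.
    nlinarith [sq_nonneg (a - b)]
  · filter_upwards [ae_restrict_mem measurableSet_Ici] with t ht htT hneg
    obtain ⟨h1, h2⟩ := hlow t ht htT
    obtain ⟨g1, -⟩ := mapsTo_state hp hl hg₀ ht
    have hlam := hp.lam_nonneg
    have k1 := (hh.2 ht).1
    have k2 := (hk.2 ht).1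
    have hlt : l t = (h t + k t) / 2 := rfl
    have hs0 : 0 ≤ (1 / p.sigma1) ^ 2 := by positivity
    unfold f
    rw [hlt]
    set a := p.state h g₀ t
    set b := p.state k g₀ t
    set g := p.state l g₀ t
    set s := (1 / p.sigma1) ^ 2
    set q := p.sigma2 ^ 2 with hq
    have hq0 : 0 ≤ q := sq_nonneg _
    set D := 2 * (a * b) - g * (a + b) with hDdef
    have ha : 0 ≤ a := by linarith
    have hb : 0 ≤ b := by linarith
    -- The product rule gives `D' = q (a + b - 2g) - R D` with this `R ≥ 0`. Where `D < 0` the last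
    -- term helps, and the first is at least `(q / m) D` because `(a + b - 2g)(a + b) = (a - b)² +
    -- 2D` and `a + b ≥ 2m`.
    have hR : 0 ≤ 4 * p.lam + (s + h t) * (a + g / 2) + (s + k t) * (b + g / 2) := by positivity
    have e1 := mul_nonneg hR (neg_nonneg.2 hneg.le)
    have e2 : D / m ≤ a + b - 2 * g := by
      by_contra! hcon
      have h3 : D / m < 0 := div_neg_of_neg_of_pos hneg hm0
      have h4 : (a + b - 2 * g) * (a + b) = (a - b) ^ 2 + 2 * D := by rw [hDdef]; ring
      have h5 : (a + b - 2 * g) * (a + b) ≤ (a + b - 2 * g) * (2 * m) :=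
        mul_le_mul_of_nonpos_left (by linarith) (by linarith)
      have h6 : (a + b - 2 * g) * (2 * m) < D / m * (2 * m) :=
        mul_lt_mul_of_pos_right hcon (by linarith)
      have h7 : D / m * (2 * m) = 2 * D := by field_simp
      linarith [sq_nonneg (a - b)]
    have e3 := mul_le_mul_of_nonneg_left e2 hq0
    have e4 : q / m * D = q * (D / m) := by ring
    rw [e4]
    refine e3.trans (sub_nonneg.1 (e1.trans (le_of_eq ?_)))
    rw [hDdef]
    ring

/-- A zero initial value has no reciprocal; it is approximated by `η > 0`, which moves every state
by at most `η`, uniformly in the control. The total error is `2η ≤ ε`. -/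
theorem state_midpoint_le (hp : p.Regular) (hh : h ∈ p.controls) (hk : k ∈ p.controls)
    {g₀ : ℝ} (hg₀ : g₀ ∈ Icc 0 p.gammaMax) {t : ℝ} (ht : 0 ≤ t) :
    p.state (fun t => (h t + k t) / 2) g₀ t ≤ (p.state h g₀ t + p.state k g₀ t) / 2 := by
  rcases hg₀.1.eq_or_lt with h0 | h0
  · refine le_of_forall_pos_le_add fun ε hε => ?_
    have hM := hp.gammaMax_pos
    set η := min (ε / 2) p.gammaMax
    have hη : 0 < η := lt_min (by linarith) hM
    have hη' : η ≤ ε / 2 := min_le_left _ _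
    have hgη : η ∈ Icc 0 p.gammaMax := ⟨hη.le, min_le_right _ _⟩
    have hclose : ∀ l ∈ p.controls, |p.state l g₀ t - p.state l η t| ≤ η := fun l hl => by
      have := abs_state_sub_state_le hp hl hl hg₀ hgη ht
      simpa [← h0, abs_of_pos hη] using this
    have h1 := abs_le.1 (hclose _ hh)
    have h2 := abs_le.1 (hclose _ hk)
    have h3 := abs_le.1 (hclose _ (midpoint_mem_controls hh hk))
    have h4 := state_midpoint_le_of_pos hp hh hk hgη hη ht
    linarith
  · exact state_midpoint_le_of_pos hp hh hk hg₀ h0 ht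

end Model

/-! ### The cost functional and existence of an optimal control. -/

namespace Model

variable {p : Model} {h k : ℝ → ℝ} {g₀ : ℝ}

theorem continuous_cost_comp_max (hp : p.Regular) : Continuous fun x : ℝ => p.c (max x 0) :=
  hp.continuousOn.comp_continuous (continuous_id.max continuous_const) fun x =>
    mem_Ici.2 (le_max_right x 0)

theorem aestronglyMeasurable_cost (hp : p.Regular) (hh : h ∈ p.controls) :
    AEStronglyMeasurable (fun t => p.c (h t)) (volume.restrict (Ici 0)) := by
  refine ((continuous_cost_comp_max hp).comp_aestronglyMeasurable
    (aestronglyMeasurable_of_mem_controls hh)).congr ?_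
  filter_upwards [ae_restrict_mem measurableSet_Ici] with t ht
  rw [max_eq_left (hh.2 ht).1]

theorem exists_bound_cost (hp : p.Regular) : ∃ C, ∀ x ∈ Icc 0 p.hMax, |p.c x| ≤ C :=
  isCompact_Icc.exists_bound_of_continuousOn (hp.continuousOn.mono fun _ hx => hx.1)

theorem integrableOn_exp (hp : p.Regular) :
    IntegrableOn (fun t => Real.exp (-p.delta * t)) (Ici 0) := by
  rw [integrableOn_Ici_iff_integrableOn_Ioi]
  exact integrableOn_exp_mul_Ioi (neg_neg_of_pos hp.delta_pos) 0

theorem integrableOn_exp_mul_of_bound (hp : p.Regular) {ψ : ℝ → ℝ} {B : ℝ}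
    (hψ : AEStronglyMeasurable ψ (volume.restrict (Ici 0))) (hB : ∀ t, 0 ≤ t → |ψ t| ≤ B) :
    IntegrableOn (fun t => Real.exp (-p.delta * t) * ψ t) (Ici 0) := by
  refine (integrableOn_exp hp).mul_bdd hψ (c := B) ?_
  filter_upwards [ae_restrict_mem measurableSet_Ici] with t ht using hB t ht

theorem aestronglyMeasurable_state (hp : p.Regular) (hh : h ∈ p.controls)
    (hg₀ : g₀ ∈ Icc 0 p.gammaMax) :
    AEStronglyMeasurable (p.state h g₀) (volume.restrict (Ici 0)) :=
  (isState_state hp hh hg₀).isPrimitiveOnIci.continuousOn.aestronglyMeasurable measurableSet_Ici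

theorem aestronglyMeasurable_k (hp : p.Regular) (hh : h ∈ p.controls)
    (hg₀ : g₀ ∈ Icc 0 p.gammaMax) :
    AEStronglyMeasurable (fun t => p.k (p.state h g₀ t) (h t)) (volume.restrict (Ici 0)) :=
  ((aestronglyMeasurable_state hp hh hg₀).const_mul p.aBar).add (aestronglyMeasurable_cost hp hh)

theorem exists_bound_k (hp : p.Regular) : ∃ B, ∀ h ∈ p.controls, ∀ g₀ ∈ Icc 0 p.gammaMax,
    ∀ t, 0 ≤ t → |p.k (p.state h g₀ t) (h t)| ≤ B := by
  obtain ⟨C, hC⟩ := exists_bound_cost hp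
  refine ⟨p.aBar * p.gammaMax + C, fun h hh g₀ hg₀ t ht => ?_⟩
  obtain ⟨a1, a2⟩ := mapsTo_state hp hh hg₀ ht
  refine (abs_add_le _ _).trans (add_le_add ?_ (hC _ (hh.2 ht)))
  rw [abs_of_nonneg (mul_nonneg hp.aBar_nonneg a1)]
  exact mul_le_mul_of_nonneg_left a2 hp.aBar_nonneg

theorem integrableOn_discountedCost (hp : p.Regular) (hh : h ∈ p.controls)
    (hg₀ : g₀ ∈ Icc 0 p.gammaMax) : IntegrableOn (p.discountedCost h g₀) (Ici 0) := by
  obtain ⟨B, hB⟩ := exists_bound_k hp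
  exact integrableOn_exp_mul_of_bound hp (aestronglyMeasurable_k hp hh hg₀) (hB h hh g₀ hg₀)

/-- Needed because the real `sInf` in `value` is a lower bound only for sets bounded below. -/
theorem bddBelow_costJ (hp : p.Regular) (hg₀ : g₀ ∈ Icc 0 p.gammaMax) :
    BddBelow ((fun h => p.costJ h g₀) '' p.controls) := by
  obtain ⟨B, hB⟩ := exists_bound_k hp
  refine ⟨∫ t in Ici 0, Real.exp (-p.delta * t) * (-B), ?_⟩
  rintro _ ⟨h, hh, rfl⟩
  refine setIntegral_mono_on ((integrableOn_exp hp).mul_const _)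
    (integrableOn_discountedCost hp hh hg₀) measurableSet_Ici fun t ht => ?_
  exact mul_le_mul_of_nonneg_left (abs_le.1 (hB h hh g₀ hg₀ t ht)).1 (Real.exp_pos _).le

theorem value_le_costJ (hp : p.Regular) (hg₀ : g₀ ∈ Icc 0 p.gammaMax) (hh : h ∈ p.controls) :
    p.value g₀ ≤ p.costJ h g₀ :=
  csInf_le (bddBelow_costJ hp hg₀) (mem_image_of_mem _ hh)

theorem zero_mem_controls (hp : p.Regular) : (fun _ => 0) ∈ p.controls :=
  ⟨measurable_const, fun _ _ => ⟨le_rfl, hp.hMax_nonneg⟩⟩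

/-- The convexity gap of the cost `c` at the midpoint. -/
noncomputable def midGap (p : Model) (x y : ℝ) : ℝ := (p.c x + p.c y) / 2 - p.c ((x + y) / 2)

theorem midGap_pos (hp : p.Regular) {x y : ℝ} (hx : 0 ≤ x) (hy : 0 ≤ y) (hxy : x ≠ y) :
    0 < p.midGap x y := by
  have := hp.strictConvexOn.2 (mem_Ici.2 hx) (mem_Ici.2 hy) hxy
    (by norm_num : (0 : ℝ) < 1 / 2) (by norm_num : (0 : ℝ) < 1 / 2) (by norm_num)
  simp only [smul_eq_mul] at this
  unfold midGap
  rw [show (x + y) / 2 = 1 / 2 * x + 1 / 2 * y by ring]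
  linarith

theorem midGap_nonneg (hp : p.Regular) {x y : ℝ} (hx : 0 ≤ x) (hy : 0 ≤ y) :
    0 ≤ p.midGap x y := by
  rcases eq_or_ne x y with rfl | hxy
  · simp [midGap]
  · exact (midGap_pos hp hx hy hxy).le

/-- Quantitative strict convexity by compactness: over pairs in `[0, hMax]²` at distance at least
`η` the gap attains a positive minimum, while distances never exceed `hMax`; `K` is the quotient. -/
theorem exists_abs_sub_le_midGap (hp : p.Regular) {η : ℝ} (hη : 0 < η) :
    ∃ K, 0 ≤ K ∧ ∀ x ∈ Icc 0 p.hMax, ∀ y ∈ Icc 0 p.hMax, |x - y| ≤ η + K * p.midGap x y := by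
  let S : Set (ℝ × ℝ) := (Icc 0 p.hMax ×ˢ Icc 0 p.hMax) ∩ {z | η ≤ |z.1 - z.2|}
  have hS : IsCompact S := (isCompact_Icc.prod isCompact_Icc).inter_right
    (isClosed_le continuous_const (by fun_prop))
  have hcont : ContinuousOn (fun z : ℝ × ℝ => p.midGap z.1 z.2) S := by
    have hc : ∀ φ : ℝ × ℝ → ℝ, Continuous φ → MapsTo φ S (Ici 0) →
        ContinuousOn (fun z => p.c (φ z)) S := fun φ h1 h2 =>
      hp.continuousOn.comp h1.continuousOn h2
    refine (((hc Prod.fst continuous_fst fun z hz => hz.1.1.1).add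
      (hc Prod.snd continuous_snd fun z hz => hz.1.2.1)).div_const 2).sub
      (hc (fun z => (z.1 + z.2) / 2) (by fun_prop) fun z hz => ?_)
    have h1 := hz.1.1.1
    have h2 := hz.1.2.1
    exact mem_Ici.2 (by positivity)
  have hnear : ∀ K, 0 ≤ K → ∀ x ∈ Icc 0 p.hMax, ∀ y ∈ Icc 0 p.hMax, (x, y) ∉ S →
      |x - y| ≤ η + K * p.midGap x y := by
    intro K hK x hx y hy hxy
    have h1 : |x - y| < η := by
      by_contra! hcon
      exact hxy ⟨⟨hx, hy⟩, hcon⟩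
    have := mul_nonneg hK (midGap_nonneg hp hx.1 hy.1)
    linarith
  rcases S.eq_empty_or_nonempty with hemp | hne
  · exact ⟨0, le_rfl, fun x hx y hy => hnear 0 le_rfl x hx y hy (by simp [hemp])⟩
  · obtain ⟨z, hz, hmin⟩ := hS.exists_isMinOn hne hcont
    have hpos : 0 < p.midGap z.1 z.2 := by
      refine midGap_pos hp hz.1.1.1 hz.1.2.1 fun heq => ?_
      have : η ≤ |z.1 - z.2| := hz.2
      rw [heq, sub_self, abs_zero] at this
      linarith
    have hK : 0 ≤ p.hMax / p.midGap z.1 z.2 := div_nonneg hp.hMax_nonneg hpos.le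
    refine ⟨_, hK, fun x hx y hy => ?_⟩
    by_cases hxy : (x, y) ∈ S
    · have h1 : p.midGap z.1 z.2 ≤ p.midGap x y := hmin hxy
      have h2 := mul_le_mul_of_nonneg_left h1 hK
      rw [div_mul_cancel₀ _ hpos.ne'] at h2
      have h3 : |x - y| ≤ p.hMax :=
        abs_sub_le_iff.2 ⟨by linarith [hx.2, hy.1], by linarith [hx.1, hy.2]⟩
      linarith
    · exact hnear _ hK x hx y hy hxy

theorem integrableOn_exp_mul_cost (hp : p.Regular) (hh : h ∈ p.controls) :
    IntegrableOn (fun t => Real.exp (-p.delta * t) * p.c (h t)) (Ici 0) := by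
  obtain ⟨C, hC⟩ := exists_bound_cost hp
  exact integrableOn_exp_mul_of_bound hp (aestronglyMeasurable_cost hp hh)
    fun t ht => hC _ (hh.2 ht)

theorem integrableOn_exp_mul_midGap (hp : p.Regular) (hh : h ∈ p.controls) (hk : k ∈ p.controls) :
    IntegrableOn (fun t => Real.exp (-p.delta * t) * p.midGap (h t) (k t)) (Ici 0) := by
  have := (((integrableOn_exp_mul_cost hp hh).add (integrableOn_exp_mul_cost hp hk)).div_const 2).sub
    (integrableOn_exp_mul_cost hp (midpoint_mem_controls hh hk))
  refine this.congr (Filter.Eventually.of_forall fun t => ?_)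
  simp only [Pi.add_apply, Pi.sub_apply, midGap]
  ring

/-- Midpoint convexity of the cost functional, with the gap of the running cost. -/
theorem costJ_midpoint_add_le (hp : p.Regular) (hh : h ∈ p.controls) (hk : k ∈ p.controls)
    (hg₀ : g₀ ∈ Icc 0 p.gammaMax) :
    p.costJ (fun t => (h t + k t) / 2) g₀ +
      ∫ t in Ici 0, Real.exp (-p.delta * t) * p.midGap (h t) (k t) ≤
      (p.costJ h g₀ + p.costJ k g₀) / 2 := by
  have hl := midpoint_mem_controls hh hk
  have i1 := integrableOn_discountedCost hp hh hg₀
  have i2 := integrableOn_discountedCost hp hk hg₀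
  have i3 := integrableOn_discountedCost hp hl hg₀
  have i4 := integrableOn_exp_mul_midGap hp hh hk
  unfold costJ
  rw [← integral_add i3 i4, ← integral_add i1 i2, ← integral_div]
  refine setIntegral_mono_on (i3.add i4) ((i1.add i2).div_const 2) measurableSet_Ici fun t ht => ?_
  have h1 := mul_le_mul_of_nonneg_left (state_midpoint_le hp hh hk hg₀ ht) hp.aBar_nonneg
  have h2 := mul_le_mul_of_nonneg_left h1 (Real.exp_pos (-p.delta * t)).le
  simp only [discountedCost, Model.k, midGap]
  linarith

theorem integrableOn_exp_mul_abs_sub (hp : p.Regular) (hh : h ∈ p.controls)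
    (hk : k ∈ p.controls) :
    IntegrableOn (fun t => Real.exp (-p.delta * t) * |h t - k t|) (Ici 0) :=
  integrableOn_exp_mul_of_bound hp (B := p.hMax)
    ((aestronglyMeasurable_of_mem_controls hh).sub (aestronglyMeasurable_of_mem_controls hk)).norm
    fun t ht => by rw [abs_abs]; exact abs_sub_le_of_mem_controls hk hh ht

/-- Almost optimal controls are close to each other. -/
theorem exists_forall_integral_abs_sub_lt (hp : p.Regular) (hg₀ : g₀ ∈ Icc 0 p.gammaMax) {ε : ℝ}
    (hε : 0 < ε) : ∃ β, 0 < β ∧ ∀ h ∈ p.controls, ∀ k ∈ p.controls,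
      p.costJ h g₀ < p.value g₀ + β → p.costJ k g₀ < p.value g₀ + β →
      ∫ t in Ici 0, Real.exp (-p.delta * t) * |h t - k t| < ε := by
  set I := ∫ t in Ici 0, Real.exp (-p.delta * t) with hI
  have hI0 : 0 ≤ I := setIntegral_nonneg measurableSet_Ici fun t _ => (Real.exp_pos _).le
  -- The tolerance `η` and the margin `β = ε / (2(K + 1))` each contribute at most `ε / 2`. Midpoint
  -- convexity bounds the integrated gap by `β`, as the midpoint control cannot beat the value.
  obtain ⟨K, hK0, hK⟩ := exists_abs_sub_le_midGap hp (η := ε / (2 * (I + 1))) (by positivity)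
  refine ⟨ε / (2 * (K + 1)), by positivity, fun h hh k hk h1 h2 => ?_⟩
  have h3 := costJ_midpoint_add_le hp hh hk hg₀
  have h4 := value_le_costJ hp hg₀ (midpoint_mem_controls hh hk)
  have i4 := integrableOn_exp_mul_midGap hp hh hk
  have h5 : ∫ t in Ici 0, Real.exp (-p.delta * t) * |h t - k t| ≤
      ∫ t in Ici 0, (Real.exp (-p.delta * t) * (ε / (2 * (I + 1))) +
        K * (Real.exp (-p.delta * t) * p.midGap (h t) (k t))) := by
    refine setIntegral_mono_on (integrableOn_exp_mul_abs_sub hp hh hk)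
      (((integrableOn_exp hp).mul_const _).add (i4.const_mul K)) measurableSet_Ici fun t ht => ?_
    have := mul_le_mul_of_nonneg_left (hK _ (hh.2 ht) _ (hk.2 ht)) (Real.exp_pos (-p.delta * t)).le
    linarith
  rw [integral_add ((integrableOn_exp hp).mul_const _) (i4.const_mul K), integral_mul_const,
    integral_const_mul, ← hI] at h5
  have h6 : I * (ε / (2 * (I + 1))) < ε / 2 := by
    rw [mul_div_assoc', div_lt_div_iff₀ (by positivity) (by norm_num)]
    nlinarith
  have h7 : K * ∫ t in Ici 0, Real.exp (-p.delta * t) * p.midGap (h t) (k t) ≤ ε / 2 := by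
    calc _ ≤ K * (ε / (2 * (K + 1))) := mul_le_mul_of_nonneg_left (by linarith) hK0
      _ ≤ ε / 2 := by
        rw [mul_div_assoc', div_le_div_iff₀ (by positivity) (by norm_num)]
        nlinarith
  linarith

theorem tendsto_state (hp : p.Regular) (hg₀ : g₀ ∈ Icc 0 p.gammaMax) {hn : ℕ → ℝ → ℝ}
    (hhn : ∀ n, hn n ∈ p.controls) (hh : h ∈ p.controls)
    (hlim : ∀ᵐ t ∂(volume.restrict (Ici 0)),
      Filter.Tendsto (fun n => hn n t) Filter.atTop (𝓝 (h t))) {t : ℝ} (ht : 0 ≤ t) :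
    Filter.Tendsto (fun n => p.state (hn n) g₀ t) Filter.atTop (𝓝 (p.state h g₀ t)) := by
  have hI : Filter.Tendsto (fun n => ∫ r in (0 : ℝ)..t, |h r - hn n r|) Filter.atTop
      (𝓝 (∫ r in (0 : ℝ)..t, (0 : ℝ))) := by
    refine intervalIntegral.tendsto_integral_filter_of_dominated_convergence (fun _ => p.hMax)
      (Filter.Eventually.of_forall fun n => ?_) (Filter.Eventually.of_forall fun n => ?_)
      intervalIntegrable_const ?_
    · rw [uIoc_of_le ht]
      exact (((aestronglyMeasurable_of_mem_controls hh).sub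
        (aestronglyMeasurable_of_mem_controls (hhn n))).norm).mono_set
        (fun r hr => mem_Ici.2 hr.1.le)
    · refine Filter.Eventually.of_forall fun r hr => ?_
      rw [uIoc_of_le ht] at hr
      rw [Real.norm_eq_abs, abs_abs]
      exact abs_sub_le_of_mem_controls (hhn n) hh hr.1.le
    · filter_upwards [(ae_restrict_iff' measurableSet_Ici).1 hlim] with r hr hmem
      rw [uIoc_of_le ht] at hmem
      have := ((hr (mem_Ici.2 hmem.1.le)).const_sub (h r)).abs
      simpa using this
  rw [tendsto_iff_dist_tendsto_zero]
  refine squeeze_zero (fun _ => dist_nonneg) (fun n => ?_)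
    (by simpa using hI.const_mul (p.gammaMax ^ 2))
  have := abs_state_sub_state_le hp (hhn n) hh hg₀ hg₀ ht
  simpa [Real.dist_eq] using this

theorem tendsto_costJ (hp : p.Regular) (hg₀ : g₀ ∈ Icc 0 p.gammaMax) {hn : ℕ → ℝ → ℝ}
    (hhn : ∀ n, hn n ∈ p.controls) (hh : h ∈ p.controls)
    (hlim : ∀ᵐ t ∂(volume.restrict (Ici 0)),
      Filter.Tendsto (fun n => hn n t) Filter.atTop (𝓝 (h t))) :
    Filter.Tendsto (fun n => p.costJ (hn n) g₀) Filter.atTop (𝓝 (p.costJ h g₀)) := by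
  obtain ⟨B, hB⟩ := exists_bound_k hp
  refine tendsto_integral_of_dominated_convergence (fun t => Real.exp (-p.delta * t) * B)
    (fun n => (integrableOn_discountedCost hp (hhn n) hg₀).1)
    ((integrableOn_exp hp).mul_const B) (fun n => ?_) ?_
  · filter_upwards [ae_restrict_mem measurableSet_Ici] with t ht
    rw [Real.norm_eq_abs, discountedCost, abs_mul, abs_of_pos (Real.exp_pos _)]
    exact mul_le_mul_of_nonneg_left (hB _ (hhn n) g₀ hg₀ t ht) (Real.exp_pos _).le
  · filter_upwards [hlim, ae_restrict_mem measurableSet_Ici] with t hlt ht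
    have h1 := (tendsto_state hp hg₀ hhn hh hlim ht).const_mul p.aBar
    have h2 : Filter.Tendsto (fun n => p.c (hn n t)) Filter.atTop (𝓝 (p.c (h t))) := by
      have := ((continuous_cost_comp_max hp).tendsto (h t)).comp hlt
      refine (this.congr fun n => ?_).trans_eq ?_
      · simp only [Function.comp]
        rw [max_eq_left ((hhn n).2 ht).1]
      · rw [max_eq_left (hh.2 ht).1]
    exact (h1.add h2).const_mul _

theorem exists_isOptimal (hp : p.Regular) (hg₀ : g₀ ∈ Icc 0 p.gammaMax) :
    ∃ h, p.IsOptimal g₀ h := by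
  have hε : ∀ n : ℕ, (0 : ℝ) < (1 / 2) ^ n := fun n => by positivity
  choose β hβ0 hβ using fun n => exists_forall_integral_abs_sub_lt hp hg₀ (hε n)
  -- Imposing all margins `β i` with `i ≤ n` makes any two terms beyond `N` closer than `(1 / 2)^N`.
  -- These bounds are summable, which gives almost everywhere convergence of the whole sequence.
  have hex : ∀ n : ℕ, ∃ h ∈ p.controls, p.costJ h g₀ < p.value g₀ + 1 / (n + 1) ∧
      ∀ i ≤ n, p.costJ h g₀ < p.value g₀ + β i := by
    intro n
    set b := (Finset.range (n + 1)).inf' ⟨0, by simp⟩ β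
    have hb : 0 < b := (Finset.lt_inf'_iff _).2 fun i _ => hβ0 i
    have hn : (0 : ℝ) < 1 / (n + 1) := by positivity
    obtain ⟨_, ⟨h, hh, rfl⟩, hlt⟩ := exists_lt_of_csInf_lt
      (Set.Nonempty.image (fun h => p.costJ h g₀) ⟨_, zero_mem_controls hp⟩)
      (lt_add_of_pos_right (p.value g₀) (lt_min hb hn))
    refine ⟨h, hh, hlt.trans_le (add_le_add le_rfl (min_le_right _ _)), fun i hi =>
      hlt.trans_le (add_le_add le_rfl ((min_le_left _ _).trans (Finset.inf'_le _ ?_)))⟩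
    simpa [Nat.lt_succ_iff] using hi
  choose hn hhn hJ hJβ using hex
  let F : ℕ → ℝ → ℝ := fun n t => Real.exp (-p.delta * t) * hn n t
  have hFm : ∀ n, AEStronglyMeasurable (F n) (volume.restrict (Ici 0)) := fun n =>
    (by fun_prop : Continuous fun t => Real.exp (-p.delta * t)).aestronglyMeasurable.mul
      (aestronglyMeasurable_of_mem_controls (hhn n))
  have hae := Lp.ae_tendsto_of_cauchy_eLpNorm (p := 1) hFm le_rfl
    (B := fun n => ENNReal.ofReal ((1 / 2) ^ n))
    (summable_geometric_of_lt_one (by norm_num) (by norm_num) : Summable fun n : ℕ =>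
      ((1 : ℝ) / 2) ^ n).tsum_ofReal_ne_top (fun N n m hNn hNm => by
      have h1 := hβ N _ (hhn n) _ (hhn m) (hJβ n N hNn) (hJβ m N hNm)
      rw [eLpNorm_one_eq_lintegral_enorm]
      have h2 : ∀ t, Real.exp (-p.delta * t) * |hn n t - hn m t| = ‖(F n - F m) t‖ := fun t => by
        simp only [F, Pi.sub_apply]
        rw [← mul_sub, Real.norm_eq_abs, abs_mul, abs_of_pos (Real.exp_pos _)]
      have h3 : IntegrableOn (F n - F m) (Ici 0) := by
        refine (integrable_norm_iff ((hFm n).sub (hFm m))).1 ?_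
        simp only [← h2]
        exact integrableOn_exp_mul_abs_sub hp (hhn n) (hhn m)
      rw [← ofReal_integral_norm_eq_lintegral_enorm h3]
      simp only [h2] at h1
      exact (ENNReal.ofReal_lt_ofReal_iff (hε N)).2 h1)
  obtain ⟨φ, hφ, hφlim⟩ := exists_stronglyMeasurable_limit_of_tendsto_ae hFm hae
  -- The limit is identified only almost everywhere; clipping makes it a control at every time and
  -- does not affect the limit, since all `hn` take values in `[0, hMax]`.
  let h : ℝ → ℝ := fun t => max 0 (min p.hMax (Real.exp (p.delta * t) * φ t))
  have hmeas : Measurable h := measurable_const.max (measurable_const.min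
    ((by fun_prop : Continuous fun t => Real.exp (p.delta * t)).measurable.mul hφ.measurable))
  have hh : h ∈ p.controls := ⟨hmeas.comp measurable_subtype_coe, fun t _ =>
    ⟨le_max_left _ _, max_le hp.hMax_nonneg (min_le_left _ _)⟩⟩
  have hlim : ∀ᵐ t ∂(volume.restrict (Ici 0)),
      Filter.Tendsto (fun n => hn n t) Filter.atTop (𝓝 (h t)) := by
    filter_upwards [hφlim, ae_restrict_mem measurableSet_Ici] with t hlt ht
    have h1 := (hlt.const_mul (Real.exp (p.delta * t)))
    have h2 := (tendsto_const_nhds (x := (0 : ℝ))).max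
      ((tendsto_const_nhds (x := p.hMax)).min h1)
    refine h2.congr fun n => ?_
    simp only [F]
    rw [← mul_assoc, ← Real.exp_add, show p.delta * t + -p.delta * t = 0 by ring, Real.exp_zero,
      one_mul, min_eq_right ((hhn n).2 ht).2, max_eq_right ((hhn n).2 ht).1]
  refine ⟨h, hh, le_antisymm ?_ (value_le_costJ hp hg₀ hh)⟩
  refine le_of_tendsto_of_tendsto' (tendsto_costJ hp hg₀ hhn hh hlim)
    (by simpa using (tendsto_one_div_add_atTop_nhds_zero_nat (𝕜 := ℝ)).const_add (p.value g₀))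
    fun n => (hJ n).le

/-! ### The adjoint variable and the maximum principle. -/

/-- `π` is the (discounted) adjoint variable along the state `γ` with control `h`. -/
structure IsAdjoint (p : Model) (h γ π : ℝ → ℝ) : Prop where
  isPrimitiveOnIci : IsPrimitiveOnIci π fun t =>
    (2 * ((1 / p.sigma1) ^ 2 + h t) * γ t + 2 * p.lam) * π t - p.aBar * Real.exp (-p.delta * t)
  nonneg : ∀ t, 0 ≤ t → 0 ≤ π t
  le_exp : ∀ t, 0 ≤ t → π t ≤ p.aBar / p.delta * Real.exp (-p.delta * t)

/-- Variation of constants, choosing the solution that decays at infinity: `π t = e^{β t} ∫_t^∞ aBar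
e^{-δs} e^{-β s} ds` with `β` a primitive of the coefficient `b ≥ 0`. Monotonicity of `β` gives `π t
≤ aBar ∫_t^∞ e^{-δs} ds`. -/
theorem exists_isAdjoint (hp : p.Regular) (hh : h ∈ p.controls) (hg₀ : g₀ ∈ Icc 0 p.gammaMax) :
    ∃ π, p.IsAdjoint h (p.state h g₀) π := by
  set γ := p.state h g₀
  have hs0 : 0 ≤ (1 / p.sigma1) ^ 2 := by positivity
  have hlam := hp.lam_nonneg
  have hH := hp.hMax_nonneg
  have ha := hp.aBar_nonneg
  have hδ := hp.delta_pos
  let b : ℝ → ℝ := fun t => 2 * ((1 / p.sigma1) ^ 2 + h t) * γ t + 2 * p.lam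
  have hb0 : ∀ t, 0 ≤ t → 0 ≤ b t := fun t ht => by
    have h1 := (mapsTo_state hp hh hg₀ (mem_Ici.2 ht)).1
    have h2 := (hh.2 (mem_Ici.2 ht)).1
    positivity
  have hbB : ∀ t, 0 ≤ t →
      |b t| ≤ 2 * ((1 / p.sigma1) ^ 2 + p.hMax) * p.gammaMax + 2 * p.lam := fun t ht => by
    obtain ⟨h1, h2⟩ := mapsTo_state hp hh hg₀ (mem_Ici.2 ht)
    obtain ⟨h3, h4⟩ := hh.2 (mem_Ici.2 ht)
    rw [abs_of_nonneg (hb0 t ht)]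
    simp only [b]
    gcongr
  have hbm : AEStronglyMeasurable b (volume.restrict (Ici 0)) :=
    ((((aestronglyMeasurable_of_mem_controls hh).const_add _).const_mul 2).mul
      (aestronglyMeasurable_state hp hh hg₀)).add_const _
  have hβ := IsPrimitiveOnIci.integral_of_bound hbm hbB
  set β : ℝ → ℝ := fun t => ∫ s in (0 : ℝ)..t, b s
  have hβmono : ∀ s t, 0 ≤ s → s ≤ t → β s ≤ β t := fun s t hs hst => by
    rw [← sub_nonneg, ← hβ.integral_eq hs (hs.trans hst)]
    exact intervalIntegral.integral_nonneg hst fun u hu => hb0 u (hs.trans hu.1)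
  have hβ0 : ∀ t, 0 ≤ t → 0 ≤ β t := fun t ht => by
    simpa [β] using hβmono 0 t le_rfl ht
  let φ : ℝ → ℝ := fun t => Real.exp (-p.delta * t) * (p.aBar * Real.exp (-β t))
  have hφ0 : ∀ t, 0 ≤ φ t := fun t => by positivity
  have hcont : ContinuousOn (fun t => p.aBar * Real.exp (-β t)) (Ici 0) :=
    continuousOn_const.mul (Real.continuous_exp.comp_continuousOn hβ.continuousOn.neg)
  have hφc : ContinuousOn φ (Ici 0) :=
    (by fun_prop : Continuous fun t => Real.exp (-p.delta * t)).continuousOn.mul hcont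
  have hφi : IntegrableOn φ (Ici 0) :=
    integrableOn_exp_mul_of_bound hp (B := p.aBar)
      (hcont.aestronglyMeasurable measurableSet_Ici) fun t ht => by
      rw [abs_of_nonneg (by positivity)]
      exact mul_le_of_le_one_right ha (Real.exp_le_one_iff.2 (neg_nonpos.2 (hβ0 t ht)))
  have hφp : IsPrimitiveOnIci (fun t => ∫ s in (0 : ℝ)..t, φ s) φ :=
    IsPrimitiveOnIci.integral_of_bound (B := p.aBar)
      (hφc.aestronglyMeasurable measurableSet_Ici) fun t ht => by
      rw [abs_of_nonneg (hφ0 t)]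
      have h1 : Real.exp (-p.delta * t) ≤ 1 :=
        Real.exp_le_one_iff.2 (by nlinarith)
      have h2 : Real.exp (-β t) ≤ 1 := Real.exp_le_one_iff.2 (neg_nonpos.2 (hβ0 t ht))
      calc φ t ≤ 1 * (p.aBar * 1) := by simp only [φ]; gcongr
        _ = p.aBar := by ring
  have hφI : IntegrableOn φ (Ioi 0) := hφi.mono_set Ioi_subset_Ici_self
  have htail : ∀ t, 0 ≤ t → (∫ s in Ioi (0 : ℝ), φ s) - ∫ s in (0 : ℝ)..t, φ s =
      ∫ s in Ioi t, φ s := fun t ht => by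
    rw [← intervalIntegral.integral_interval_add_Ioi' (hφp.intervalIntegrable le_rfl ht)
      (hφI.mono_set (Ioi_subset_Ioi ht))]
    ring
  have hE := hβ.contDiff_comp (φ := Real.exp) (φ' := Real.exp) Real.contDiff_exp
    Real.hasDerivAt_exp
  -- The tail integral is written as a constant minus a primitive, to which the product rule
  -- applies.
  have hR := (IsPrimitiveOnIci.const (∫ s in Ioi (0 : ℝ), φ s)).sub hφp
  refine ⟨_, (hE.mul hR).congr_deriv (Filter.Eventually.of_forall fun t => ?_), ?_, ?_⟩
  · have h1 : Real.exp (β t) * φ t = p.aBar * Real.exp (-p.delta * t) := by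
      simp only [φ]
      rw [show Real.exp (β t) * (Real.exp (-p.delta * t) * (p.aBar * Real.exp (-β t))) =
        p.aBar * Real.exp (-p.delta * t) * (Real.exp (β t) * Real.exp (-β t)) by ring,
        ← Real.exp_add, add_neg_cancel, Real.exp_zero, mul_one]
    rw [← h1]
    simp only [b]
    ring
  · intro t ht
    rw [htail t ht]
    exact mul_nonneg (Real.exp_pos _).le (setIntegral_nonneg measurableSet_Ioi fun s _ => hφ0 s)
  · intro t ht
    rw [htail t ht]
    have h1 : ∫ s in Ioi t, φ s ≤
        ∫ s in Ioi t, Real.exp (-p.delta * s) * (p.aBar * Real.exp (-β t)) := by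
      refine setIntegral_mono_on (hφI.mono_set (Ioi_subset_Ioi ht))
        ((integrableOn_exp_mul_Ioi (neg_neg_of_pos hδ) t).mul_const _) measurableSet_Ioi
        fun s hs => ?_
      have := hβmono t s ht (le_of_lt hs)
      simp only [φ]
      gcongr
    rw [integral_mul_const, integral_exp_mul_Ioi (neg_neg_of_pos hδ)] at h1
    calc Real.exp (β t) * ∫ s in Ioi t, φ s
        ≤ Real.exp (β t) * (-Real.exp (-p.delta * t) / -p.delta * (p.aBar * Real.exp (-β t))) :=
          mul_le_mul_of_nonneg_left h1 (Real.exp_pos _).le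
      _ = p.aBar / p.delta * Real.exp (-p.delta * t) * (Real.exp (β t) * Real.exp (-β t)) := by
          rw [neg_div_neg_eq]; ring
      _ = p.aBar / p.delta * Real.exp (-p.delta * t) := by
          rw [← Real.exp_add, add_neg_cancel, Real.exp_zero, mul_one]

theorem IsAdjoint.integrableOn_mul {γ π ψ : ℝ → ℝ} (hπ : p.IsAdjoint h γ π) (hp : p.Regular)
    {B : ℝ} (hψ : AEStronglyMeasurable ψ (volume.restrict (Ici 0)))
    (hB : ∀ t, 0 ≤ t → |ψ t| ≤ B) : IntegrableOn (fun t => π t * ψ t) (Ici 0) := by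
  have hπm := hπ.isPrimitiveOnIci.continuousOn.aestronglyMeasurable (μ := volume) measurableSet_Ici
  refine Integrable.mul_bdd (c := B) (((integrableOn_exp hp).const_mul
    (p.aBar / p.delta)).mono' hπm ?_) hψ ?_
  · filter_upwards [ae_restrict_mem measurableSet_Ici] with t ht
    rw [Real.norm_eq_abs, abs_of_nonneg (hπ.nonneg t ht)]
    exact hπ.le_exp t ht
  · filter_upwards [ae_restrict_mem measurableSet_Ici] with t ht using hB t ht

theorem integrableOn_adjoint_mul {l π : ℝ → ℝ} {γ : ℝ → ℝ} (hp : p.Regular)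
    (hπ : p.IsAdjoint h γ π) (hh : h ∈ p.controls) (hk : k ∈ p.controls) (hl : l ∈ p.controls)
    (hg₀ : g₀ ∈ Icc 0 p.gammaMax) :
    IntegrableOn (fun t => π t * ((k t - h t) * p.state l g₀ t ^ 2)) (Ici 0) := by
  refine hπ.integrableOn_mul hp (B := p.hMax * p.gammaMax ^ 2)
    (((aestronglyMeasurable_of_mem_controls hk).sub (aestronglyMeasurable_of_mem_controls hh)).mul
      ((aestronglyMeasurable_state hp hl hg₀).pow 2)) fun t ht => ?_
  obtain ⟨h1, h2⟩ := mapsTo_state hp hl hg₀ (mem_Ici.2 ht)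
  have hH := hp.hMax_nonneg
  rw [abs_mul, abs_of_nonneg (sq_nonneg (p.state l g₀ t))]
  exact mul_le_mul (abs_sub_le_of_mem_controls hh hk ht) (by gcongr) (sq_nonneg _) hH

/-- With `z` the difference of the two states, `(π z)' = -A - π ((1 / σ₁)² + h) z²`, the quadratic
term expressing concavity of the drift. Since `π ≥ 0`, the integral of `A` over `[0, T]` is at most
`-π T * z T`, which is bounded above by a multiple of `e^{-δT}`. -/
theorem costJ_sub_costJ_le {π : ℝ → ℝ} (hp : p.Regular) (hh : h ∈ p.controls)
    (hk : k ∈ p.controls) (hg₀ : g₀ ∈ Icc 0 p.gammaMax)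
    (hπ : p.IsAdjoint h (p.state h g₀) π) :
    p.costJ k g₀ - p.costJ h g₀ ≤ ∫ t in Ici 0,
      (Real.exp (-p.delta * t) * (p.c (k t) - p.c (h t)) -
        π t * ((k t - h t) * p.state k g₀ t ^ 2)) := by
  have sh := isState_state hp hh hg₀
  have sk := isState_state hp hk hg₀
  have i1 := integrableOn_discountedCost hp hh hg₀
  have i2 := integrableOn_discountedCost hp hk hg₀
  have i3 := integrableOn_exp_mul_cost hp hh
  have i4 := integrableOn_exp_mul_cost hp hk
  have i5 := integrableOn_adjoint_mul hp hπ hh hk hk hg₀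
  have i6 : IntegrableOn (fun t => Real.exp (-p.delta * t) * (p.c (k t) - p.c (h t)) -
      π t * ((k t - h t) * p.state k g₀ t ^ 2)) (Ici 0) := by
    refine ((i4.sub i3).sub i5).congr (Filter.Eventually.of_forall fun t => ?_)
    simp only [Pi.sub_apply]
    ring
  let A : ℝ → ℝ := fun t => p.aBar * Real.exp (-p.delta * t) * (p.state k g₀ t - p.state h g₀ t) +
    π t * ((k t - h t) * p.state k g₀ t ^ 2)
  have hAe : ∀ t, A t = p.discountedCost k g₀ t - p.discountedCost h g₀ t -
      (Real.exp (-p.delta * t) * (p.c (k t) - p.c (h t)) -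
        π t * ((k t - h t) * p.state k g₀ t ^ 2)) := fun t => by
    simp only [A, discountedCost, Model.k]
    ring
  have iA : IntegrableOn A (Ici 0) :=
    ((i2.sub i1).sub i6).congr (Filter.Eventually.of_forall fun t => (hAe t).symm)
  have hz := hπ.isPrimitiveOnIci.mul (sk.isPrimitiveOnIci.sub sh.isPrimitiveOnIci)
  have hint : ∀ T, 0 ≤ T → ∫ t in (0 : ℝ)..T, A t ≤
      p.aBar / p.delta * p.gammaMax * Real.exp (-p.delta * T) := by
    intro T hT
    have h1 := hz.integral_eq le_rfl hT
    have h2 : ∫ t in (0 : ℝ)..T, A t ≤ -(π T * (p.state k g₀ T - p.state h g₀ T)) := by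
      simp only [sk.init, sh.init, sub_self, mul_zero, sub_zero] at h1
      rw [← h1, ← intervalIntegral.integral_neg]
      refine intervalIntegral.integral_mono_on hT ?_ (hz.intervalIntegrable le_rfl hT).neg
        fun t ht => ?_
      · rw [intervalIntegrable_iff_integrableOn_Icc_of_le hT]
        exact iA.mono_set fun t ht => ht.1
      · have h3 := hπ.nonneg t ht.1
        have h4 := (hh.2 (mem_Ici.2 ht.1)).1
        have h5 : 0 ≤ π t * (((1 / p.sigma1) ^ 2 + h t) *
          (p.state k g₀ t - p.state h g₀ t) ^ 2) := by positivity
        simp only [A, f]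
        linarith
    obtain ⟨a1, a2⟩ := mapsTo_state hp hh hg₀ (mem_Ici.2 hT)
    obtain ⟨b1, b2⟩ := mapsTo_state hp hk hg₀ (mem_Ici.2 hT)
    have h6 := hπ.nonneg T hT
    have h7 := hπ.le_exp T hT
    calc _ ≤ π T * (p.state h g₀ T - p.state k g₀ T) := by linarith
      _ ≤ π T * p.gammaMax := mul_le_mul_of_nonneg_left (by linarith) h6
      _ ≤ p.aBar / p.delta * Real.exp (-p.delta * T) * p.gammaMax :=
        mul_le_mul_of_nonneg_right h7 hp.gammaMax_pos.le
      _ = _ := by ring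
  have hA : ∫ t in Ici 0, A t ≤ 0 := by
    rw [integral_Ici_eq_integral_Ioi]
    have l1 := intervalIntegral_tendsto_integral_Ioi 0 (iA.mono_set Ioi_subset_Ici_self)
      Filter.tendsto_id
    have l2 : Filter.Tendsto (fun T => p.aBar / p.delta * p.gammaMax * Real.exp (-p.delta * T))
        Filter.atTop (𝓝 0) := by
      have : Filter.Tendsto (fun T => Real.exp (-p.delta * T)) Filter.atTop (𝓝 0) :=
        Real.tendsto_exp_atBot.comp
          (Filter.tendsto_id.const_mul_atTop_of_neg (neg_neg_of_pos hp.delta_pos))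
      simpa using this.const_mul (p.aBar / p.delta * p.gammaMax)
    refine le_of_tendsto_of_tendsto l1 l2 ?_
    filter_upwards [Filter.eventually_ge_atTop 0] with T hT using hint T hT
  have hsum : ∫ t in Ici 0, A t = p.costJ k g₀ - p.costJ h g₀ - ∫ t in Ici 0,
      (Real.exp (-p.delta * t) * (p.c (k t) - p.c (h t)) -
        π t * ((k t - h t) * p.state k g₀ t ^ 2)) := by
    have e := integral_sub (i2.sub i1) i6
    simp only [Pi.sub_apply] at e
    unfold costJ
    rw [← integral_sub i2 i1, ← e]
    exact integral_congr_ae (Filter.Eventually.of_forall hAe)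
  linarith

/-- The maximum principle in integrated form. -/
theorem IsOptimal.integral_nonneg {l π : ℝ → ℝ} (hp : p.Regular) (hopt : p.IsOptimal g₀ h)
    (hl : l ∈ p.controls) (hg₀ : g₀ ∈ Icc 0 p.gammaMax)
    (hπ : p.IsAdjoint h (p.state h g₀) π) :
    0 ≤ ∫ t in Ici 0, (Real.exp (-p.delta * t) * (p.c (l t) - p.c (h t)) -
      π t * ((l t - h t) * p.state h g₀ t ^ 2)) := by
  have hh := hopt.1
  let θ : ℕ → ℝ := fun n => 1 / ((n : ℝ) + 1)
  have hθ0 : ∀ n, 0 < θ n := fun n => by positivity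
  have hθ1 : ∀ n, θ n ≤ 1 := fun n => by
    simp only [θ]
    rw [div_le_one (by positivity)]
    linarith [(Nat.cast_nonneg n : (0 : ℝ) ≤ n)]
  have hθlim : Filter.Tendsto θ Filter.atTop (𝓝 0) := tendsto_one_div_add_atTop_nhds_zero_nat
  let κ : ℕ → ℝ → ℝ := fun n t => h t + θ n * (l t - h t)
  have hκ : ∀ n, κ n ∈ p.controls := fun n =>
    add_mul_sub_mem_controls hh hl ⟨(hθ0 n).le, hθ1 n⟩
  have hκlim : ∀ t, Filter.Tendsto (fun n => κ n t) Filter.atTop (𝓝 (h t)) := fun t => by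
    simpa using (hθlim.mul_const (l t - h t)).const_add (h t)
  have ic : IntegrableOn (fun t => Real.exp (-p.delta * t) * (p.c (l t) - p.c (h t))) (Ici 0) := by
    refine ((integrableOn_exp_mul_cost hp hl).sub (integrableOn_exp_mul_cost hp hh)).congr
      (Filter.Eventually.of_forall fun t => ?_)
    simp only [Pi.sub_apply]
    ring
  have ia : ∀ m ∈ p.controls,
      IntegrableOn (fun t => π t * ((l t - h t) * p.state m g₀ t ^ 2)) (Ici 0) := fun m hm =>
    integrableOn_adjoint_mul hp hπ hh hl hm hg₀
  have hpos : ∀ n, 0 ≤ ∫ t in Ici 0, (Real.exp (-p.delta * t) * (p.c (l t) - p.c (h t)) -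
      π t * ((l t - h t) * p.state (κ n) g₀ t ^ 2)) := by
    intro n
    have h1 := costJ_sub_costJ_le hp hh (hκ n) hg₀ hπ
    have h2 := value_le_costJ hp hg₀ (hκ n)
    rw [← hopt.2] at h2
    have h3 : ∫ t in Ici 0, (Real.exp (-p.delta * t) * (p.c (κ n t) - p.c (h t)) -
        π t * ((κ n t - h t) * p.state (κ n) g₀ t ^ 2)) ≤
        ∫ t in Ici 0, θ n * (Real.exp (-p.delta * t) * (p.c (l t) - p.c (h t)) -
          π t * ((l t - h t) * p.state (κ n) g₀ t ^ 2)) := by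
      refine setIntegral_mono_on ?_ ((ic.sub (ia _ (hκ n))).const_mul _) measurableSet_Ici
        fun t ht => ?_
      · refine (((integrableOn_exp_mul_cost hp (hκ n)).sub
          (integrableOn_exp_mul_cost hp hh)).sub
          (integrableOn_adjoint_mul hp hπ hh (hκ n) (hκ n) hg₀)).congr
          (Filter.Eventually.of_forall fun t => ?_)
        simp only [Pi.sub_apply]
        ring
      -- Convexity of `c` along the segment from `h` to `l` lets `θ n` factor out, so it can be
      -- divided away; only the state still depends on `n`.
      · have h4 := hp.strictConvexOn.convexOn.2
        have h5 := h4 (mem_Ici.2 (hh.2 ht).1) (mem_Ici.2 (hl.2 ht).1) (sub_nonneg.2 (hθ1 n))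
          (hθ0 n).le (by ring)
        simp only [smul_eq_mul] at h5
        have h6 : (1 - θ n) * h t + θ n * l t = κ n t := by simp only [κ]; ring
        rw [h6] at h5
        have h7 : κ n t - h t = θ n * (l t - h t) := by simp only [κ]; ring
        rw [h7]
        have h8 := mul_le_mul_of_nonneg_left h5 (Real.exp_pos (-p.delta * t)).le
        linarith
    rw [integral_const_mul] at h3
    exact nonneg_of_mul_nonneg_right (by linarith) (hθ0 n)
  have hlim : Filter.Tendsto (fun n => ∫ t in Ici 0,
      (Real.exp (-p.delta * t) * (p.c (l t) - p.c (h t)) -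
        π t * ((l t - h t) * p.state (κ n) g₀ t ^ 2))) Filter.atTop
      (𝓝 (∫ t in Ici 0, (Real.exp (-p.delta * t) * (p.c (l t) - p.c (h t)) -
        π t * ((l t - h t) * p.state h g₀ t ^ 2)))) := by
    have ib : IntegrableOn (fun t => π t * (p.hMax * p.gammaMax ^ 2)) (Ici 0) :=
      hπ.integrableOn_mul hp aestronglyMeasurable_const fun t _ => le_rfl
    refine tendsto_integral_of_dominated_convergence
      (fun t => ‖Real.exp (-p.delta * t) * (p.c (l t) - p.c (h t))‖ +
        π t * (p.hMax * p.gammaMax ^ 2))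
      (fun n => (ic.sub (ia _ (hκ n))).1) (ic.norm.add ib) (fun n => ?_) ?_
    · filter_upwards [ae_restrict_mem measurableSet_Ici] with t ht
      refine (norm_sub_le _ _).trans (add_le_add le_rfl ?_)
      obtain ⟨a1, a2⟩ := mapsTo_state hp (hκ n) hg₀ ht
      have hH := hp.hMax_nonneg
      rw [Real.norm_eq_abs, abs_mul, abs_of_nonneg (hπ.nonneg t ht), abs_mul,
        abs_of_nonneg (sq_nonneg (p.state (κ n) g₀ t))]
      exact mul_le_mul_of_nonneg_left (mul_le_mul (abs_sub_le_of_mem_controls hh hl ht)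
        (by gcongr) (sq_nonneg _) hH) (hπ.nonneg t ht)
    · filter_upwards [ae_restrict_mem measurableSet_Ici] with t ht
      have := tendsto_state hp hg₀ hκ hh (Filter.Eventually.of_forall hκlim) ht
      exact (((this.pow 2).const_mul _).const_mul _).const_sub _
  exact ge_of_tendsto' hlim hpos

/-! ### Continuity of the optimal control. -/

/-- The minimizer of the Hamiltonian depends continuously on the marginal value. -/
theorem exists_continuous_argmin (hp : p.Regular) :
    ∃ Φ : ℝ → ℝ, Continuous Φ ∧ ∀ m, Φ m ∈ Icc 0 p.hMax ∧
      ∀ x ∈ Icc 0 p.hMax, x ≠ Φ m → p.c (Φ m) - m * Φ m < p.c x - m * x := by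
  have hcont : ∀ m : ℝ, ContinuousOn (fun x => p.c x - m * x) (Icc 0 p.hMax) := fun m =>
    (hp.continuousOn.mono fun _ hx => hx.1).sub (by fun_prop)
  have hex : ∀ m : ℝ, ∃ x ∈ Icc 0 p.hMax, IsMinOn (fun x => p.c x - m * x) (Icc 0 p.hMax) x :=
    fun m => isCompact_Icc.exists_isMinOn (nonempty_Icc.2 hp.hMax_nonneg) (hcont m)
  choose Φ hΦ hmin using hex
  have hstrict : ∀ m, ∀ x ∈ Icc 0 p.hMax, x ≠ Φ m → p.c (Φ m) - m * Φ m < p.c x - m * x := by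
    intro m x hx hne
    refine lt_of_le_of_ne (hmin m hx) fun heq => ?_
    have h0 := hp.strictConvexOn.2
    have h1 := h0 (mem_Ici.2 hx.1) (mem_Ici.2 (hΦ m).1) hne
      (by norm_num : (0 : ℝ) < 1 / 2) (by norm_num : (0 : ℝ) < 1 / 2) (by norm_num)
    simp only [smul_eq_mul] at h1
    have h2 : p.c (Φ m) - m * Φ m ≤
        p.c (1 / 2 * x + 1 / 2 * Φ m) - m * (1 / 2 * x + 1 / 2 * Φ m) :=
      hmin m ⟨by linarith [hx.1, (hΦ m).1], by linarith [hx.2, (hΦ m).2]⟩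
    linarith
  refine ⟨Φ, ?_, fun m => ⟨hΦ m, hstrict m⟩⟩
  rw [Metric.continuous_iff]
  intro m ε hε
  let S : Set ℝ := Icc 0 p.hMax ∩ {x | ε ≤ dist x (Φ m)}
  have hS : IsCompact S := isCompact_Icc.inter_right
    (isClosed_le continuous_const (by fun_prop))
  rcases S.eq_empty_or_nonempty with hemp | hne
  · refine ⟨1, one_pos, fun m' _ => ?_⟩
    by_contra! hcon
    have : Φ m' ∈ S := ⟨hΦ m', hcon⟩
    simp [hemp] at this
  · obtain ⟨y, hy, hymin⟩ := hS.exists_isMinOn hne ((hcont m).mono inter_subset_left)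
    have hyne : y ≠ Φ m := fun heq => by
      have h1 : ε ≤ dist y (Φ m) := hy.2
      rw [heq, dist_self] at h1
      linarith
    have hlt := hstrict m y hy.1 hyne
    have hH := hp.hMax_nonneg
    -- Points at distance at least `ε` from `Φ m` lose at least the numerator. Moving `m` to `m'`
    -- changes the comparison of two points by at most `|m' - m| * hMax`; the `+ 1` covers `hMax =
    -- 0`.
    refine ⟨(p.c y - m * y - (p.c (Φ m) - m * Φ m)) / (p.hMax + 1),
      div_pos (sub_pos.2 hlt) (by linarith), fun m' hm' => ?_⟩
    by_contra! hcon
    have h1 : p.c y - m * y ≤ p.c (Φ m') - m * Φ m' := hymin ⟨hΦ m', hcon⟩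
    have h2 : p.c (Φ m') - m' * Φ m' ≤ p.c (Φ m) - m' * Φ m := hmin m' (hΦ m)
    rw [lt_div_iff₀ (by linarith), Real.dist_eq] at hm'
    have h3 : (m' - m) * (Φ m' - Φ m) ≤ |m' - m| * p.hMax := by
      refine (le_abs_self _).trans ?_
      rw [abs_mul]
      refine mul_le_mul_of_nonneg_left (abs_sub_le_iff.2 ⟨?_, ?_⟩) (abs_nonneg _)
      · linarith [(hΦ m').2, (hΦ m).1]
      · linarith [(hΦ m').1, (hΦ m).2]
    linarith [abs_nonneg (m' - m)]

/-- The pointwise minimizer of `x ↦ c x - m t * x` is itself an admissible test control. The maximum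
principle makes the integral of a nonnegative loss nonpositive, so the loss vanishes almost
everywhere, and uniqueness of the minimizer identifies `h`. -/
theorem exists_continuousOn_isOptimal (hp : p.Regular) (hg₀ : g₀ ∈ Icc 0 p.gammaMax) :
    ∃ l, p.IsOptimal g₀ l ∧ ContinuousOn l (Ici 0) := by
  obtain ⟨h, hopt⟩ := exists_isOptimal hp hg₀
  have hh := hopt.1
  obtain ⟨π, hπ⟩ := exists_isAdjoint hp hh hg₀
  obtain ⟨Φ, hΦ, hΦmin⟩ := exists_continuous_argmin hp
  let m : ℝ → ℝ := fun t => Real.exp (p.delta * t) * π t * p.state h g₀ t ^ 2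
  have hm : ContinuousOn m (Ici 0) :=
    ((by fun_prop : Continuous fun t => Real.exp (p.delta * t)).continuousOn.mul
      hπ.isPrimitiveOnIci.continuousOn).mul
      ((isState_state hp hh hg₀).isPrimitiveOnIci.continuousOn.pow 2)
  have hlc : ContinuousOn (fun t => Φ (m t)) (Ici 0) := hΦ.comp_continuousOn hm
  have hl : (fun t => Φ (m t)) ∈ p.controls :=
    ⟨(continuousOn_iff_continuous_domRestrict.1 hlc).measurable, fun t _ => (hΦmin (m t)).1⟩
  have hnn := hopt.integral_nonneg hp hl hg₀ hπ
  have hE : ∀ t, Real.exp (-p.delta * t) * (p.c (Φ (m t)) - p.c (h t)) -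
      π t * ((Φ (m t) - h t) * p.state h g₀ t ^ 2) = -(Real.exp (-p.delta * t) *
        ((p.c (h t) - m t * h t) - (p.c (Φ (m t)) - m t * Φ (m t)))) := by
    intro t
    have h1 : Real.exp (-p.delta * t) * m t = π t * p.state h g₀ t ^ 2 := by
      simp only [m]
      rw [← mul_assoc, ← mul_assoc, ← Real.exp_add, show -p.delta * t + p.delta * t = 0 by ring,
        Real.exp_zero, one_mul]
    linear_combination (Φ (m t) - h t) * h1
  have hle : ∀ t, 0 ≤ t → 0 ≤ Real.exp (-p.delta * t) *
      ((p.c (h t) - m t * h t) - (p.c (Φ (m t)) - m t * Φ (m t))) := by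
    intro t ht
    refine mul_nonneg (Real.exp_pos _).le (sub_nonneg.2 ?_)
    rcases eq_or_ne (h t) (Φ (m t)) with heq | hne
    · rw [heq]
    · exact ((hΦmin (m t)).2 _ (hh.2 (mem_Ici.2 ht)) hne).le
  have hint : IntegrableOn (fun t => Real.exp (-p.delta * t) *
      ((p.c (h t) - m t * h t) - (p.c (Φ (m t)) - m t * Φ (m t)))) (Ici 0) := by
    refine (((integrableOn_exp_mul_cost hp hh).sub (integrableOn_exp_mul_cost hp hl)).add
      (integrableOn_adjoint_mul hp hπ hh hl hh hg₀)).congr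
      (Filter.Eventually.of_forall fun t => ?_)
    have := hE t
    simp only [Pi.sub_apply, Pi.add_apply]
    linarith
  simp only [hE] at hnn
  rw [integral_neg] at hnn
  have hzero := (setIntegral_eq_zero_iff_of_nonneg_ae
    ((ae_restrict_mem measurableSet_Ici).mono hle) hint).1
    (le_antisymm (by linarith) (setIntegral_nonneg measurableSet_Ici hle))
  have heq : h =ᵐ[volume.restrict (Ici 0)] fun t => Φ (m t) := by
    filter_upwards [hzero, ae_restrict_mem measurableSet_Ici] with t ht hmem
    by_contra hne
    have h1 := (hΦmin (m t)).2 _ (hh.2 hmem) hne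
    have h2 := mul_pos (Real.exp_pos (-p.delta * t)) (sub_pos.2 h1)
    simp only [Pi.zero_apply] at ht
    linarith
  exact ⟨_, ⟨hl, (costJ_congr_control heq g₀).symm.trans hopt.2⟩, hlc⟩

end Model

/-! ### Deriving the working assumptions from the parameters. -/

namespace Model

variable {p : Model}

theorem aBar_eq (hlam : 0 ≤ p.lam) (hdelta : 0 < p.delta) (hrho : 0 < p.rho) :
    p.aBar = p.a3 ^ 2 / (2 * p.rho) := by
  have h1 : 2 * p.lam + p.delta ≠ 0 := by positivity
  unfold aBar a2
  field_simp
  ring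

theorem gammaInf_nonneg (hlam : 0 ≤ p.lam) : 0 ≤ p.gammaInf := by
  have h1 : p.lam * p.sigma1 ^ 2 ≤
      √(p.lam ^ 2 * p.sigma1 ^ 4 + p.sigma1 ^ 2 * p.sigma2 ^ 2) := by
    refine Real.le_sqrt_of_sq_le ?_
    nlinarith [mul_nonneg (sq_nonneg p.sigma1) (sq_nonneg p.sigma2)]
  unfold gammaInf
  linarith

/-- `gammaInf` is the larger root of the downward parabola `f(·, 0)`, which is therefore nonpositive
to its right; completing the square makes this explicit. -/
theorem f_gammaMax_nonpos (hlam : 0 ≤ p.lam) (hsigma1 : 0 < p.sigma1)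
    (hgammaMax : p.gammaInf < p.gammaMax) : p.f p.gammaMax 0 ≤ 0 := by
  have h0 := (gammaInf_nonneg hlam).trans_lt hgammaMax
  have h1 : √(p.lam ^ 2 * p.sigma1 ^ 4 + p.sigma1 ^ 2 * p.sigma2 ^ 2) <
      p.gammaMax + p.lam * p.sigma1 ^ 2 := by
    unfold gammaInf at hgammaMax
    linarith
  have h2 := (Real.sqrt_lt' (by positivity)).1 h1
  have h3 : p.f p.gammaMax 0 * p.sigma1 ^ 2 = p.sigma1 ^ 2 * p.sigma2 ^ 2 +
      p.lam ^ 2 * p.sigma1 ^ 4 - (p.gammaMax + p.lam * p.sigma1 ^ 2) ^ 2 := by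
    unfold f
    field_simp
    ring
  refine nonpos_of_mul_nonpos_left (b := p.sigma1 ^ 2) ?_ (by positivity)
  rw [h3]
  linarith

end Model

theorem mainTheorem9 (p : Model)
    (hlam : 0 ≤ p.lam) (hsigma1 : 0 < p.sigma1) (hsigma2 : 0 ≤ p.sigma2)
    (hkappa : 0 < p.kappa) (hrho : 0 < p.rho) (hdelta : 0 < p.delta)
    (hgammaMax : p.gammaInf < p.gammaMax)
    (hc_nonneg : ∀ x ∈ Set.Ici (0 : ℝ), 0 ≤ p.c x)
    (hc_convex : StrictConvexOn ℝ (Set.Ici 0) p.c)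
    (hc_smooth : ContDiffOn ℝ 2 p.c (Set.Ici 0))
    (hc_mono : StrictMonoOn p.c (Set.Ici 0))
    (hM0 : p.M0 ∈ p.cDeriv '' Set.Ici 0)
    (g0 : ℝ) (hg0 : g0 ∈ Set.Icc 0 p.gammaMax) :
    -- the reduced problem is well posed: for every control the state exists, is unique, takes
    -- values in `[0, gammaMax]`, and the discounted cost is integrable
    (∀ h ∈ p.controls,
      p.IsState h g0 (p.state h g0) ∧
      (∀ g : ℝ → ℝ, p.IsState h g0 g → Set.EqOn g (p.state h g0) (Set.Ici 0)) ∧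
      Set.MapsTo (p.state h g0) (Set.Ici 0) (Set.Icc 0 p.gammaMax) ∧
      MeasureTheory.IntegrableOn (p.discountedCost h g0) (Set.Ici 0)) ∧
    -- and there is an optimal control that is continuous
    ∃ h : ℝ → ℝ, p.IsOptimal g0 h ∧ ContinuousOn h (Set.Ici 0) := by
  have hp : p.Regular :=
    { lam_nonneg := hlam
      delta_pos := hdelta
      aBar_nonneg := by rw [Model.aBar_eq hlam hdelta hrho]; positivity
      gammaMax_pos := (Model.gammaInf_nonneg hlam).trans_lt hgammaMax
      hMax_nonneg := Function.invFunOn_mem hM0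
      drift_gammaMax := Model.f_gammaMax_nonpos hlam hsigma1 hgammaMax
      strictConvexOn := hc_convex
      continuousOn := hc_smooth.continuousOn }
  refine ⟨fun h hh => ⟨Model.isState_state hp hh hg0, fun g hg => ?_,
    Model.mapsTo_state hp hh hg0, Model.integrableOn_discountedCost hp hh hg0⟩,
    Model.exists_continuousOn_isOptimal hp hg0⟩
  exact hg.eqOn hp hh (Model.isState_state hp hh hg0)
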